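/- Let $\Omega=(a,b)$ be a bounded open interval, $a<b$. Let $\mathrm{BV}(\Omega)$ be the space of functions $u\in L^1(\Omega)$ (up to a.e. equality) whose distributional derivative is a finite signed Radon measure $Du$ on $\Omega$, and let $|Du|$ be the total variation measure of $Du$. For $f\in\mathrm{BV}(\Omega)$ and $\alpha\in C(\overline\Omega)$ with $\alpha>0$ on $\overline\Omega$, let $S_\alpha(f)$ denote the unique minimiser over $u\in \mathrm{BV}(\Omega)$ of $$\frac12\int_\Omega (f-u)^2\,dx+\int_\Omega \alpha(x)\,d|Du|(x).$$ Proposition 3.12 (partial semigroup property). Let $f\in \mathrm{BV}(\Omega)$, let $\alpha_1\in C(\overline\Omega)$ with $\alpha_1>0$ on $\overline\Omega$, and let $\alpha_2>0$ be a scalar. Then each of the three minimisation problems involved has exactly one minimiser, and $$S_{\alpha_1+\alpha_2}(f)=S_{\alpha_2}\bigl(S_{\alpha_1}(f)\bigr).$$ -/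

import Mathlib

open MeasureTheory Set
open scoped ContDiff

noncomputable section

namespace WeightedTV

/-- The space `L¹(Ω)` for the interval `Ω = (a, b)`: classes of Lebesgue integrable real functions
up to Lebesgue-a.e. equality on `(a, b)`. -/
abbrev L1 (a b : ℝ) : Type := Lp ℝ 1 (volume.restrict (Ioo a b))

/-- The finite signed Borel measure `μ` on `Ω = (a, b)` is the distributional derivative of `u`,
i.e. `∫_Ω u φ' dx = - ∫_Ω φ dμ` for every `φ ∈ C_c^∞(Ω)`. Signed measures on `Ω` are encoded as
signed measures on `ℝ` that are carried by `(a, b)`. -/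
structure IsDistribDeriv {a b : ℝ} (u : L1 a b) (μ : SignedMeasure ℝ) : Prop where
  restrict_eq : VectorMeasure.restrict μ (Ioo a b) = μ
  integral_eq : ∀ φ : ℝ → ℝ, ContDiff ℝ ∞ φ → HasCompactSupport φ → tsupport φ ⊆ Ioo a b →
    ∫ x in Ioo a b, u x * deriv φ x = - ∫ᵛ x, φ x ∂<•μ

/-- `BV(Ω)`, `Ω = (a, b)`: the functions in `L¹(Ω)` whose distributional derivative is a finite
signed Radon measure on `Ω`. -/
def BV (a b : ℝ) : Set (L1 a b) := {u | ∃ μ : SignedMeasure ℝ, IsDistribDeriv u μ}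

theorem integral_signedMeasure (μ : SignedMeasure ℝ) (φ : ℝ → ℝ)
    (hφ : Integrable φ μ.totalVariation) :
    ∫ᵛ x, φ x ∂<•μ = ∫ x, φ x ∂μ.toJordanDecomposition.posPart
      - ∫ x, φ x ∂μ.toJordanDecomposition.negPart := by
  rw [SignedMeasure.totalVariation, integrable_add_measure] at hφ
  conv_lhs => rw [← SignedMeasure.toSignedMeasure_toJordanDecomposition μ,
    JordanDecomposition.toSignedMeasure]
  rw [VectorMeasure.integral_sub_vectorMeasure]
  · simp
  · simpa [VectorMeasure.Integrable] using hφ.1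
  · simpa [VectorMeasure.Integrable] using hφ.2

theorem IsDistribDeriv.unique {a b : ℝ} {u : L1 a b} {μ ν : SignedMeasure ℝ}
    (hμ : IsDistribDeriv u μ) (hν : IsDistribDeriv u ν) : μ = ν := by
  have hcont : ∀ (σ : SignedMeasure ℝ) (φ : ℝ → ℝ), ContDiff ℝ ∞ φ → HasCompactSupport φ →
      Integrable φ σ.totalVariation :=
    fun σ φ h1 h2 => h1.continuous.integrable_of_hasCompactSupport h2
  set δ : SignedMeasure ℝ := μ - ν with hδ
  have hres : δ.restrict (Ioo a b) = δ := by
    rw [hδ, VectorMeasure.restrict_sub, hμ.restrict_eq, hν.restrict_eq]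
  have hvar : δ.totalVariation = δ.totalVariation.restrict (Ioo a b) := by
    rw [SignedMeasure.totalVariation_eq_variation,
      ← VectorMeasure.variation_restrict measurableSet_Ioo, hres]
  have hint : ∀ φ : ℝ → ℝ, ContDiff ℝ ∞ φ → HasCompactSupport φ → tsupport φ ⊆ Ioo a b →
      ∫ᵛ x, φ x ∂<•δ = 0 := by
    intro φ h1 h2 h3
    have e1 := hμ.integral_eq φ h1 h2 h3
    have e2 := hν.integral_eq φ h1 h2 h3
    rw [hδ, VectorMeasure.integral_sub_vectorMeasure]
    · linarith
    · simpa [VectorMeasure.Integrable, SignedMeasure.totalVariation_eq_variation]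
        using hcont μ φ h1 h2
    · simpa [VectorMeasure.Integrable, SignedMeasure.totalVariation_eq_variation]
        using hcont ν φ h1 h2
  obtain ⟨i, hi, hP, hN⟩ := δ.toJordanDecomposition.mutuallySingular
  set P := δ.toJordanDecomposition.posPart with hPdef
  set N := δ.toJordanDecomposition.negPart with hNdef
  have htv : δ.totalVariation = P + N := rfl
  classical
  set s : ℝ → ℝ := i.piecewise (fun _ => -1) (fun _ => 1) with hs
  have hsP : ∀ᵐ x ∂P, s x = 1 := by
    have : ∀ᵐ x ∂P, x ∉ i := measure_eq_zero_iff_ae_notMem.1 hP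
    filter_upwards [this] with x hx
    simp [hs, hx]
  have hsN : ∀ᵐ x ∂N, s x = -1 := by
    have : ∀ᵐ x ∂N, x ∉ iᶜ := measure_eq_zero_iff_ae_notMem.1 hN
    filter_upwards [this] with x hx
    have hx' : x ∈ i := by simpa using hx
    simp [hs, hx']
  have hsm : Measurable s := measurable_const.piecewise hi measurable_const
  have hsb : ∀ x, ‖s x‖ ≤ 1 := by
    intro x
    by_cases hx : x ∈ i <;> simp [hs, hx]
  have hsi : ∀ (ρ : Measure ℝ) [IsFiniteMeasure ρ], Integrable s ρ := fun ρ _ =>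
    Integrable.of_bound hsm.aestronglyMeasurable 1 (Filter.Eventually.of_forall hsb)
  have key : ∀ᵐ x ∂δ.totalVariation, x ∈ Ioo a b → s x = 0 := by
    refine isOpen_Ioo.ae_eq_zero_of_integral_contDiff_smul_eq_zero
      ((hsi _).locallyIntegrable.locallyIntegrableOn _) ?_
    intro g h1 h2 h3
    have hgi := hcont δ g h1 h2
    have hgs : Integrable (fun x => g x • s x) δ.totalVariation := by
      simpa [mul_comm] using hgi.bdd_mul hsm.aestronglyMeasurable
        (Filter.Eventually.of_forall hsb)
    rw [htv] at hgs ⊢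
    rw [integrable_add_measure] at hgs
    rw [integral_add_measure hgs.1 hgs.2]
    have e1 : ∫ x, g x • s x ∂P = ∫ x, g x ∂P :=
      integral_congr_ae (by filter_upwards [hsP] with x hx; simp [hx])
    have e2 : ∫ x, g x • s x ∂N = - ∫ x, g x ∂N := by
      rw [← integral_neg]
      exact integral_congr_ae (by filter_upwards [hsN] with x hx; simp [hx])
    have e3 := hint g h1 h2 h3
    rw [integral_signedMeasure δ g hgi] at e3
    rw [e1, e2]
    linarith
  have hzero : δ.totalVariation = 0 := by
    have : ∀ᵐ x ∂δ.totalVariation, False := by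
      rw [hvar] at key ⊢
      filter_upwards [key, ae_restrict_mem measurableSet_Ioo] with x h1 h2
      have := h1 h2
      by_cases hx : x ∈ i <;> simp [hs, hx] at this
    simpa using this
  have : δ = 0 := by
    ext j _
    simpa using δ.null_of_totalVariation_zero (i := j) (by simp [hzero])
  exact sub_eq_zero.1 this

open Classical in
/-- The measure `Du` of a function `u` of bounded variation (unique by `IsDistribDeriv.unique`);
the value `0` is a convention for `u ∉ BV(Ω)`, where `Du` is never used. -/
def D {a b : ℝ} (u : L1 a b) : SignedMeasure ℝ :=
  if h : ∃ μ : SignedMeasure ℝ, IsDistribDeriv u μ then h.choose else 0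

theorem isDistribDeriv_D {a b : ℝ} {u : L1 a b} (hu : u ∈ BV a b) : IsDistribDeriv u (D u) := by
  have h : ∃ μ : SignedMeasure ℝ, IsDistribDeriv u μ := hu
  rw [D, dif_pos h]
  exact h.choose_spec

/-- The weighted total variation `∫_Ω α d|Du|`. -/
def weightedTV {a b : ℝ} (α : ℝ → ℝ) (u : L1 a b) : ℝ :=
  ∫ x in Ioo a b, α x ∂(D u).totalVariation

/-- The functional `½ ∫_Ω (f - u)² dx + ∫_Ω α d|Du|`. In dimension one `BV(Ω) ⊆ L^∞(Ω)`, so for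
`f, u ∈ BV(Ω)` and `α` continuous on `[a, b]` both integrands are integrable. -/
def energy {a b : ℝ} (α : ℝ → ℝ) (f u : L1 a b) : ℝ :=
  1 / 2 * (∫ x in Ioo a b, (f x - u x) ^ 2) + weightedTV α u

/-- `S_α(f)`: the set of all minimisers over `BV(Ω)` of `u ↦ ½ ∫_Ω (f - u)² dx + ∫_Ω α d|Du|`. -/
def S {a b : ℝ} (α : ℝ → ℝ) (f : L1 a b) : Set (L1 a b) :=
  {u | u ∈ BV a b ∧ ∀ w ∈ BV a b, energy α f u ≤ energy α f w}

end WeightedTV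

end

noncomputable section

namespace WeightedTV

/-! Minimality is read off the primitive `Z(x) = ∫_a^x (u - f)`. It is enough that `Z(b) = 0`, `|Z|
≤ α`, `Z = α` almost everywhere for `(Du)⁺` and `Z = -α` almost everywhere for `(Du)⁻` (`IsCert`).
Integration by parts then gives `-∫ w (u - f) = ∫ Z dDw ≤ ∫ α d|Dw|` for every `w` in BV, with
equality at `w = u`. Hence the energy of `w` exceeds that of `u` by at least `½‖u - w‖²`, so `u` is
the only minimiser (`IsCert.S_eq`).

For the semigroup law, let `u` be certified for `(α₁, f)` and `w` for `(α₂, u)`. The primitives add,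
and so do the bounds `|Z| ≤ α`. The contact conditions add provided `Z₁ = ±α₁` also holds almost
everywhere for `(Dw)^±`, which follows from `(Dw)^± ≪ (Du)^±` (`IsCert.comp`). This is where
constancy of `α₂` enters: `Z₂` attains its maximum on `{Z₂ = α₂}`, and since `Z₂' = w - u` this
forces `D(w - u) ≤ 0` there (`IsRep.measure_le_of_primitive_eq_max`).

Certificates come from duality (`exists_isCert`): take `u = f - p`, with `p` the `L²` projection of
`f` onto the mean-zero functions whose primitive is bounded by `α`. The variational inequality for
`p` bounds the variation of `u`, and complementary slackness gives the contact conditions. -/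

/-! ### Functions of bounded variation as distribution functions -/

/-- Integration by parts against a finite measure carried by `(a, b)`. -/
theorem integral_cdf_mul {a b : ℝ} (hab : a < b) (P : Measure ℝ) [IsFiniteMeasure P]
    (hP : P (Ioo a b)ᶜ = 0) {g : ℝ → ℝ} (hg : IntervalIntegrable g volume a b)
    (h0 : ∫ x in a..b, g x = 0) :
    ∫ x in Ioo a b, P.real (Iic x) * g x = - ∫ t, (∫ x in a..t, g x) ∂P := by
  have hgi : IntegrableOn g (Ioo a b) := (intervalIntegrable_iff_integrableOn_Ioo_of_le hab.le).1 hg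
  -- Fubini on the region `t ≤ x`: the inner integral over `x` is `∫_t^b g`, which is `-∫_a^t g`
  -- because `g` has zero mean.
  set F : ℝ × ℝ → ℝ := {z : ℝ × ℝ | z.2 ≤ z.1}.indicator (fun z => g z.1) with hF
  have hFi : Integrable F ((volume.restrict (Ioo a b)).prod P) :=
    (hgi.comp_fst P).indicator (measurableSet_le measurable_snd measurable_fst)
  have e1 : ∀ x, ∫ t, F (x, t) ∂P = P.real (Iic x) * g x := by
    intro x
    have : (fun t => F (x, t)) = (Iic x).indicator (fun _ => g x) := by
      ext t; simp [hF, indicator]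
    rw [this, integral_indicator_const _ measurableSet_Iic, smul_eq_mul]
  have e2 : ∀ᵐ t ∂P, ∫ x in Ioo a b, F (x, t) = - ∫ x in a..t, g x := by
    have : ∀ᵐ t ∂P, t ∈ Ioo a b := hP
    filter_upwards [this] with t ht
    have : (fun x => F (x, t)) = (Ici t).indicator g := by
      ext x; simp [hF, indicator]
    rw [this, setIntegral_indicator measurableSet_Ici,
      show Ioo a b ∩ Ici t = Ico t b by ext x; simp; grind, integral_Ico_eq_integral_Ioo,
      ← integral_Ioc_eq_integral_Ioo, ← intervalIntegral.integral_of_le ht.2.le]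
    have h1 : IntervalIntegrable g volume a t :=
      hg.mono_set (by rw [uIcc_of_le ht.1.le, uIcc_of_le hab.le]; exact Icc_subset_Icc_right ht.2.le)
    have h2 : IntervalIntegrable g volume t b :=
      hg.mono_set (by rw [uIcc_of_le ht.2.le, uIcc_of_le hab.le]; exact Icc_subset_Icc_left ht.1.le)
    have := intervalIntegral.integral_add_adjacent_intervals h1 h2
    linarith
  calc ∫ x in Ioo a b, P.real (Iic x) * g x = ∫ x in Ioo a b, (∫ t, F (x, t) ∂P) := by simp_rw [e1]
    _ = ∫ t, (∫ x in Ioo a b, F (x, t)) ∂P := by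
      exact integral_integral_swap (f := fun x t => F (x, t)) hFi
    _ = _ := by rw [integral_congr_ae e2, integral_neg]

/-- `u` coincides a.e. on `(a, b)` with a constant plus the distribution function of `P - N`. -/
structure IsRep (a b : ℝ) (u : ℝ → ℝ) (P N : Measure ℝ) : Prop where
  finite_left : IsFiniteMeasure P
  finite_right : IsFiniteMeasure N
  carried_left : P (Ioo a b)ᶜ = 0
  carried_right : N (Ioo a b)ᶜ = 0
  exists_ae_eq : ∃ c, u =ᵐ[volume.restrict (Ioo a b)] fun x => c + P.real (Iic x) - N.real (Iic x)

theorem measurable_cdf (P : Measure ℝ) [IsFiniteMeasure P] : Measurable fun x => P.real (Iic x) :=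
  Monotone.measurable fun _ _ h => measureReal_mono (Iic_subset_Iic.2 h)

theorem IsRep.exists_bound {a b : ℝ} {u : ℝ → ℝ} {P N : Measure ℝ} (h : IsRep a b u P N) :
    ∃ C, ∀ᵐ x ∂volume.restrict (Ioo a b), ‖u x‖ ≤ C := by
  obtain ⟨_, _, _, _, c, hc⟩ := h
  refine ⟨|c| + P.real univ + N.real univ, ?_⟩
  filter_upwards [hc] with x hx
  rw [hx, Real.norm_eq_abs]
  have h1 : P.real (Iic x) ≤ P.real univ := measureReal_mono (subset_univ _)
  have h2 : N.real (Iic x) ≤ N.real univ := measureReal_mono (subset_univ _)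
  have h3 : 0 ≤ P.real (Iic x) := measureReal_nonneg
  have h4 : 0 ≤ N.real (Iic x) := measureReal_nonneg
  rw [abs_le]
  constructor <;> cases abs_cases c <;> linarith

theorem IsRep.memLp {a b : ℝ} {u : ℝ → ℝ} {P N : Measure ℝ} (h : IsRep a b u P N)
    (p : ENNReal) : MemLp u p (volume.restrict (Ioo a b)) := by
  obtain ⟨C, hC⟩ := h.exists_bound
  refine MemLp.of_bound ?_ C hC
  obtain ⟨_, _, _, _, c, hc⟩ := h
  exact (((measurable_cdf P).const_add c).sub (measurable_cdf N)).aestronglyMeasurable.congr hc.symm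

theorem IsRep.neg {a b : ℝ} {u : ℝ → ℝ} {P N : Measure ℝ} (h : IsRep a b u P N) :
    IsRep a b (-u) N P := by
  obtain ⟨h1, h2, h3, h4, c, hc⟩ := h
  refine ⟨h2, h1, h4, h3, -c, ?_⟩
  filter_upwards [hc] with x hx
  rw [Pi.neg_apply, hx]; ring

/-- The two measures need not be mutually singular, so a difference is represented by crosswise sums
without computing its Jordan decomposition. -/
theorem IsRep.sub {a b : ℝ} {u v : ℝ → ℝ} {P N P' N' : Measure ℝ} (h : IsRep a b u P N)
    (h' : IsRep a b v P' N') : IsRep a b (u - v) (P + N') (N + P') := by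
  obtain ⟨h1, h2, h3, h4, c, hc⟩ := h
  obtain ⟨h1', h2', h3', h4', c', hc'⟩ := h'
  refine ⟨inferInstance, inferInstance, by simp [h3, h4'], by simp [h4, h3'], c - c', ?_⟩
  filter_upwards [hc, hc'] with x hx hx'
  rw [Pi.sub_apply, hx, hx', measureReal_add_apply, measureReal_add_apply]
  ring

theorem integrable_of_continuousOn_Icc {a b : ℝ} {P : Measure ℝ} [IsFiniteMeasure P]
    (hP : P (Ioo a b)ᶜ = 0) {φ : ℝ → ℝ} (hφ : ContinuousOn φ (Icc a b)) : Integrable φ P := by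
  have : P.restrict (Icc a b) = P := by
    rw [Measure.restrict_eq_self_of_ae_mem]
    have : ∀ᵐ t ∂P, t ∈ Ioo a b := hP
    exact this.mono fun x hx => Ioo_subset_Icc_self hx
  rw [← this]
  exact hφ.integrableOn_compact isCompact_Icc

theorem IsRep.integral_mul {a b : ℝ} (hab : a < b) {u : ℝ → ℝ} {P N : Measure ℝ}
    (h : IsRep a b u P N) {g : ℝ → ℝ} (hg : IntervalIntegrable g volume a b)
    (h0 : ∫ x in a..b, g x = 0) :
    ∫ x in Ioo a b, u x * g x
      = ∫ t, (∫ x in a..t, g x) ∂N - ∫ t, (∫ x in a..t, g x) ∂P := by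
  obtain ⟨_, _, h3, h4, c, hc⟩ := h
  have hgi : IntegrableOn g (Ioo a b) := (intervalIntegrable_iff_integrableOn_Ioo_of_le hab.le).1 hg
  have hb : ∀ (Q : Measure ℝ) [IsFiniteMeasure Q],
      Integrable (fun x => Q.real (Iic x) * g x) (volume.restrict (Ioo a b)) := by
    intro Q _
    refine Integrable.bdd_mul (c := Q.real univ) hgi (measurable_cdf Q).aestronglyMeasurable ?_
    filter_upwards with x
    rw [Real.norm_of_nonneg measureReal_nonneg]
    exact measureReal_mono (subset_univ _)
  have : ∫ x in Ioo a b, u x * g x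
      = ∫ x in Ioo a b, (c * g x + P.real (Iic x) * g x - N.real (Iic x) * g x) :=
    integral_congr_ae (by filter_upwards [hc] with x hx; rw [hx]; ring)
  have hcg : Integrable (fun x => c * g x) (volume.restrict (Ioo a b)) := hgi.const_mul c
  rw [this, integral_sub (by exact hcg.add (hb P)) (hb N), integral_add hcg (hb P),
    integral_const_mul, integral_cdf_mul hab P h3 hg h0,
    integral_cdf_mul hab N h4 hg h0]
  rw [intervalIntegral.integral_of_le hab.le, integral_Ioc_eq_integral_Ioo] at h0
  rw [h0]; ring

/-- A weakly differentiable function on `(a, b)` with vanishing weak derivative is constant. -/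
theorem ae_eq_const_of_integral_mul_deriv_eq_zero {a b : ℝ} (hab : a < b) {u : ℝ → ℝ}
    (hu : IntegrableOn u (Ioo a b))
    (h : ∀ φ : ℝ → ℝ, ContDiff ℝ ∞ φ → HasCompactSupport φ → tsupport φ ⊆ Ioo a b →
      ∫ x in Ioo a b, u x * deriv φ x = 0) :
    ∃ c, u =ᵐ[volume.restrict (Ioo a b)] fun _ => c := by
  obtain ⟨ρ, hρs, hρc, hρd, hρ1⟩ : ∃ ρ : ℝ → ℝ, tsupport ρ ⊆ Ioo a b ∧ HasCompactSupport ρ ∧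
      ContDiff ℝ ∞ ρ ∧ ∫ x, ρ x = 1 := by
    let B : ContDiffBump ((a + b) / 2) := ⟨(b - a) / 8, (b - a) / 4, by linarith, by linarith⟩
    refine ⟨B.normed volume, ?_, B.hasCompactSupport_normed, B.contDiff_normed,
      B.integral_normed⟩
    rw [B.tsupport_normed_eq, Real.closedBall_eq_Icc]
    intro x hx
    simp only [B, mem_Icc] at hx
    constructor <;> linarith
  have hset : ∀ ψ : ℝ → ℝ, tsupport ψ ⊆ Ioo a b → ∀ v : ℝ → ℝ,
      ∫ x in Ioo a b, v x * ψ x = ∫ x, v x * ψ x := by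
    intro ψ hψ v
    refine setIntegral_eq_integral_of_forall_compl_eq_zero fun x hx => ?_
    rw [image_eq_zero_of_notMem_tsupport fun h => hx (hψ h), mul_zero]
  have hint : ∀ ψ : ℝ → ℝ, ContDiff ℝ ∞ ψ → HasCompactSupport ψ →
      IntegrableOn (fun x => u x * ψ x) (Ioo a b) := by
    intro ψ h1 h2
    obtain ⟨C, hC⟩ := h2.exists_bound_of_continuous h1.continuous
    exact hu.mul_bdd (c := C) h1.continuous.aestronglyMeasurable (Filter.Eventually.of_forall hC)
  set c := ∫ x in Ioo a b, u x * ρ x with hc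
  refine ⟨c, ?_⟩
  suffices H : ∀ᵐ x ∂volume.restrict (Ioo a b), x ∈ Ioo a b → u x - c = 0 by
    filter_upwards [H, ae_restrict_mem measurableSet_Ioo] with x h1 h2
    linarith [h1 h2]
  have huc : IntegrableOn (fun x => u x - c) (Ioo a b) := hu.sub (integrable_const c)
  refine isOpen_Ioo.ae_eq_zero_of_integral_contDiff_smul_eq_zero
    (huc.locallyIntegrable.locallyIntegrableOn _) ?_
  intro ψ hψd hψc hψs
  -- Subtracting `k ρ` makes the integral vanish, so the primitive of `ψ - k ρ` is again compactly
  -- supported in `(a, b)` and is an allowed test function.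
  set k := ∫ x, ψ x with hk
  set g : ℝ → ℝ := fun x => ψ x - k * ρ x with hg
  have hgd : ContDiff ℝ ∞ g := hψd.sub (contDiff_const.mul hρd)
  have hgi : ∀ x y, IntervalIntegrable g volume x y :=
    fun x y => hgd.continuous.intervalIntegrable x y
  set φ : ℝ → ℝ := fun x => ∫ t in a..x, g t with hφ
  have hφ' : ∀ x, HasDerivAt φ (g x) x := fun x =>
    intervalIntegral.integral_hasDerivAt_right (hgi a x)
      hgd.continuous.aestronglyMeasurable.stronglyMeasurableAtFilter hgd.continuous.continuousAt
  have hdφ : deriv φ = g := funext fun x => (hφ' x).deriv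
  have hφd : ContDiff ℝ ∞ φ :=
    contDiff_infty_iff_deriv.2 ⟨fun x => (hφ' x).differentiableAt, hdφ ▸ hgd⟩
  have hg0 : ∫ x in a..b, g x = 0 := by
    rw [intervalIntegral.integral_of_le hab.le, integral_Ioc_eq_integral_Ioo]
    have h1 := hset ψ hψs fun _ => 1
    have h2 := hset ρ hρs fun _ => 1
    simp only [one_mul] at h1 h2
    rw [integral_sub, integral_const_mul, h1, h2, hρ1, hk]
    · ring
    · exact (hψd.continuous.integrable_of_hasCompactSupport hψc).integrableOn
    · exact ((hρd.continuous.integrable_of_hasCompactSupport hρc).const_mul k).integrableOn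
  obtain ⟨l, r, hal, hlr, hrb, hsupp⟩ : ∃ l r, a < l ∧ l ≤ r ∧ r < b ∧
      ∀ x, x ∉ Icc l r → g x = 0 := by
    -- The midpoint is added only as an explicit witness of nonemptiness.
    have hT : IsCompact (tsupport ψ ∪ tsupport ρ ∪ {(a + b) / 2}) :=
      (hψc.isCompact.union hρc.isCompact).union isCompact_singleton
    have hTs : tsupport ψ ∪ tsupport ρ ∪ {(a + b) / 2} ⊆ Ioo a b := by
      refine union_subset (union_subset hψs hρs) (singleton_subset_iff.2 ⟨?_, ?_⟩) <;> linarith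
    have hne : (tsupport ψ ∪ tsupport ρ ∪ {(a + b) / 2}).Nonempty := ⟨_, Or.inr rfl⟩
    obtain ⟨l, hl⟩ := hT.exists_isLeast hne
    obtain ⟨r, hr⟩ := hT.exists_isGreatest hne
    refine ⟨l, r, (hTs hl.1).1, hl.2 hr.1, (hTs hr.1).2, fun x hx => ?_⟩
    have hx' : ∀ y ∈ tsupport ψ ∪ tsupport ρ ∪ {(a + b) / 2}, y ≠ x := by
      rintro y hy rfl
      exact hx ⟨hl.2 hy, hr.2 hy⟩
    have h1 : x ∉ tsupport ψ := fun h => hx' x (Or.inl (Or.inl h)) rfl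
    have h2 : x ∉ tsupport ρ := fun h => hx' x (Or.inl (Or.inr h)) rfl
    simp [hg, image_eq_zero_of_notMem_tsupport h1, image_eq_zero_of_notMem_tsupport h2]
  have hφ0 : ∀ x, x ∉ Icc l r → φ x = 0 := by
    intro x hx
    rw [mem_Icc, not_and_or, not_le, not_le] at hx
    rcases hx with hx | hx
    · refine intervalIntegral.integral_zero_ae (Filter.Eventually.of_forall fun t ht => ?_)
      refine hsupp t fun h => ?_
      have := (mem_uIoc.1 ht)
      rcases this with h' | h' <;> linarith [h.1]
    · rw [hφ]
      simp only
      rw [← intervalIntegral.integral_add_adjacent_intervals (hgi a b) (hgi b x), hg0, zero_add]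
      refine intervalIntegral.integral_zero_ae (Filter.Eventually.of_forall fun t ht => ?_)
      refine hsupp t fun h => ?_
      have := (mem_uIoc.1 ht)
      rcases this with h' | h' <;> linarith [h.2]
  have hφs : tsupport φ ⊆ Icc l r :=
    closure_minimal (fun x hx => by_contra fun h => hx (hφ0 x h)) isClosed_Icc
  have key := h φ hφd (HasCompactSupport.of_support_subset_isCompact isCompact_Icc
    ((subset_tsupport φ).trans hφs)) (hφs.trans fun x hx => ⟨hal.trans_le hx.1, hx.2.trans_lt hrb⟩)
  rw [hdφ] at key
  have e1 : ∫ x in Ioo a b, u x * g x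
      = (∫ x in Ioo a b, u x * ψ x) - k * c := by
    rw [hc, ← integral_const_mul, ← integral_sub (hint ψ hψd hψc) ((hint ρ hρd hρc).const_mul k)]
    refine integral_congr_ae (Filter.Eventually.of_forall fun x => ?_)
    simp only [hg]; ring
  have e2 : ∫ x in Ioo a b, c * ψ x = c * k :=
    (hset ψ hψs fun _ => c).trans (integral_const_mul c ψ)
  have e3 : ∫ x in Ioo a b, ψ x • (u x - c)
      = (∫ x in Ioo a b, u x * ψ x) - ∫ x in Ioo a b, c * ψ x := by
    rw [← integral_sub (hint ψ hψd hψc)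
      ((hψd.continuous.integrable_of_hasCompactSupport hψc).integrableOn.const_mul c)]
    refine integral_congr_ae (Filter.Eventually.of_forall fun x => ?_)
    simp only [smul_eq_mul]; ring
  rw [e3, e2]
  linarith

theorem integral_deriv_eq {a b : ℝ} {φ : ℝ → ℝ} (h1 : ContDiff ℝ ∞ φ)
    (h3 : tsupport φ ⊆ Ioo a b) (t : ℝ) : ∫ x in a..t, deriv φ x = φ t := by
  have hc : Continuous (deriv φ) := h1.continuous_deriv (by simp)
  rw [intervalIntegral.integral_deriv_eq_sub (fun x _ => (h1.differentiable (by simp)).differentiableAt)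
    (hc.intervalIntegrable _ _), image_eq_zero_of_notMem_tsupport fun h => (h3 h).1.ne rfl, sub_zero]

theorem IsRep.integral_mul_deriv {a b : ℝ} (hab : a < b) {u : ℝ → ℝ} {P N : Measure ℝ}
    (h : IsRep a b u P N) {φ : ℝ → ℝ} (h1 : ContDiff ℝ ∞ φ) (h3 : tsupport φ ⊆ Ioo a b) :
    ∫ x in Ioo a b, u x * deriv φ x = ∫ t, φ t ∂N - ∫ t, φ t ∂P := by
  have hc : Continuous (deriv φ) := h1.continuous_deriv (by simp)
  have := h.integral_mul hab (hc.intervalIntegrable a b) (by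
    rw [integral_deriv_eq h1 h3, image_eq_zero_of_notMem_tsupport fun h => (h3 h).2.ne rfl])
  simpa only [integral_deriv_eq h1 h3] using this

theorem IsRep.mem_BV {a b : ℝ} (hab : a < b) {u : L1 a b} {P N : Measure ℝ}
    (h : IsRep a b u P N) : u ∈ BV a b := by
  have := h.finite_left
  have := h.finite_right
  refine ⟨P.toSignedMeasure - N.toSignedMeasure, ?_, fun φ h1 h2 h3 => ?_⟩
  · have hr : ∀ (Q : Measure ℝ) [IsFiniteMeasure Q], Q (Ioo a b)ᶜ = 0 →
        Q.toSignedMeasure.restrict (Ioo a b) = Q.toSignedMeasure := by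
      intro Q _ hQ
      rw [VectorMeasure.restrict_toSignedMeasure measurableSet_Ioo]
      exact Measure.toSignedMeasure_congr (Measure.restrict_eq_self_of_ae_mem hQ)
    rw [VectorMeasure.restrict_sub, hr P h.carried_left, hr N h.carried_right]
  · rw [h.integral_mul_deriv hab h1 h3, VectorMeasure.integral_sub_vectorMeasure]
    · simp
    · simpa [VectorMeasure.Integrable] using h1.continuous.integrable_of_hasCompactSupport h2
    · simpa [VectorMeasure.Integrable] using h1.continuous.integrable_of_hasCompactSupport h2

/-- Subtracting the distribution function of `μ` leaves a function with vanishing weak derivative,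
hence a constant. -/
theorem IsDistribDeriv.isRep {a b : ℝ} (hab : a < b) {u : L1 a b} {μ : SignedMeasure ℝ}
    (h : IsDistribDeriv u μ) :
    IsRep a b u μ.toJordanDecomposition.posPart μ.toJordanDecomposition.negPart := by
  set P := μ.toJordanDecomposition.posPart
  set N := μ.toJordanDecomposition.negPart
  have htv : μ.totalVariation (Ioo a b)ᶜ = 0 := by
    have : μ.totalVariation = μ.totalVariation.restrict (Ioo a b) := by
      rw [SignedMeasure.totalVariation_eq_variation,
        ← VectorMeasure.variation_restrict measurableSet_Ioo, h.restrict_eq]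
    rw [this, Measure.restrict_apply measurableSet_Ioo.compl]
    simp
  have hPN : P (Ioo a b)ᶜ = 0 ∧ N (Ioo a b)ᶜ = 0 := by
    simpa [SignedMeasure.totalVariation] using htv
  set v : ℝ → ℝ := fun x => P.real (Iic x) - N.real (Iic x) with hv
  have hvr : IsRep a b v P N := ⟨inferInstance, inferInstance, hPN.1, hPN.2, 0, by simp [hv]⟩
  have hvi : Integrable v (volume.restrict (Ioo a b)) := memLp_one_iff_integrable.1 (hvr.memLp 1)
  have hui : Integrable u (volume.restrict (Ioo a b)) := L1.integrable_coeFn u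
  obtain ⟨c, hc⟩ := ae_eq_const_of_integral_mul_deriv_eq_zero hab (u := fun x => u x - v x)
    (hui.sub hvi) (fun φ h1 h2 h3 => by
      have hd : Continuous (deriv φ) := h1.continuous_deriv (by simp)
      obtain ⟨C, hC⟩ := h2.deriv.exists_bound_of_continuous hd
      simp_rw [sub_mul]
      rw [integral_sub (hui.mul_bdd hd.aestronglyMeasurable (Filter.Eventually.of_forall hC))
        (hvi.mul_bdd hd.aestronglyMeasurable (Filter.Eventually.of_forall hC)),
        h.integral_eq φ h1 h2 h3, hvr.integral_mul_deriv hab h1 h3,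
        integral_signedMeasure μ φ (h1.continuous.integrable_of_hasCompactSupport h2)]
      ring)
  refine ⟨inferInstance, inferInstance, hPN.1, hPN.2, c, ?_⟩
  filter_upwards [hc] with x hx
  simp only [hv] at hx
  linarith

/-- The positive and negative parts of `Du`. -/
def Dpos {a b : ℝ} (u : L1 a b) : Measure ℝ := (D u).toJordanDecomposition.posPart

def Dneg {a b : ℝ} (u : L1 a b) : Measure ℝ := (D u).toJordanDecomposition.negPart

theorem isRep_D {a b : ℝ} (hab : a < b) {u : L1 a b} (hu : u ∈ BV a b) :
    IsRep a b u (Dpos u) (Dneg u) :=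
  (isDistribDeriv_D hu).isRep hab

instance {a b : ℝ} (u : L1 a b) : IsFiniteMeasure (Dpos u) :=
  inferInstanceAs (IsFiniteMeasure (D u).toJordanDecomposition.posPart)

instance {a b : ℝ} (u : L1 a b) : IsFiniteMeasure (Dneg u) :=
  inferInstanceAs (IsFiniteMeasure (D u).toJordanDecomposition.negPart)

theorem exists_Dpos_Dneg_separation {a b : ℝ} (u : L1 a b) :
    ∃ s, MeasurableSet s ∧ Dpos u s = 0 ∧ Dneg u sᶜ = 0 :=
  (D u).toJordanDecomposition.mutuallySingular

theorem weightedTV_eq {a b : ℝ} (hab : a < b) {α : ℝ → ℝ} (hα : ContinuousOn α (Icc a b))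
    {u : L1 a b} (hu : u ∈ BV a b) :
    weightedTV α u = ∫ x, α x ∂Dpos u + ∫ x, α x ∂Dneg u := by
  obtain ⟨_, _, h3, h4, -⟩ := isRep_D hab hu
  have h : (Dpos u + Dneg u).restrict (Ioo a b) = Dpos u + Dneg u :=
    Measure.restrict_eq_self_of_ae_mem (by
      rw [ae_add_measure_iff]
      exact ⟨h3, h4⟩)
  rw [weightedTV, show (D u).totalVariation = Dpos u + Dneg u from rfl, h,
    integral_add_measure (integrable_of_continuousOn_Icc h3 hα)
      (integrable_of_continuousOn_Icc h4 hα)]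

/-! ### Optimality conditions and uniqueness of the minimiser -/

/-- The first order optimality conditions for `u = S_α(f)`. -/
structure IsCert {a b : ℝ} (α : ℝ → ℝ) (f u : L1 a b) : Prop where
  mem_BV : u ∈ BV a b
  integral_eq_zero : ∫ x in a..b, (u x - f x) = 0
  abs_primitive_le : ∀ x ∈ Ioo a b, |∫ t in a..x, (u t - f t)| ≤ α x
  eq_pos : ∀ᵐ x ∂Dpos u, ∫ t in a..x, (u t - f t) = α x
  eq_neg : ∀ᵐ x ∂Dneg u, ∫ t in a..x, (u t - f t) = - α x

theorem intervalIntegrable_sub {a b : ℝ} (hab : a < b) (u f : L1 a b) :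
    IntervalIntegrable (fun x => u x - f x) volume a b :=
  (intervalIntegrable_iff_integrableOn_Ioo_of_le hab.le).2
    ((L1.integrable_coeFn u).sub (L1.integrable_coeFn f))

theorem continuousOn_primitive {a b : ℝ} (hab : a < b) {g : ℝ → ℝ}
    (hg : IntervalIntegrable g volume a b) :
    ContinuousOn (fun x => ∫ t in a..x, g t) (Icc a b) := by
  simpa [uIcc_of_le hab.le] using intervalIntegral.continuousOn_primitive_interval' hg left_mem_uIcc

/-- The primitive of `u - f` is a dual certificate: paired with any `Dw` it stays below the weighted
variation, and it attains it at `Du`. -/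
theorem IsCert.S_eq {a b : ℝ} (hab : a < b) {α : ℝ → ℝ} (hα : ContinuousOn α (Icc a b))
    {f u : L1 a b} (hf : f ∈ BV a b) (h : IsCert α f u) : S α f = {u} := by
  have hgi := intervalIntegrable_sub hab u f
  set Z : ℝ → ℝ := fun x => ∫ t in a..x, (u t - f t) with hZ
  have hZc : ContinuousOn Z (Icc a b) := continuousOn_primitive hab hgi
  have hu := h.mem_BV
  have hfr := isRep_D hab hf
  have hur := isRep_D hab hu
  have hint : ∀ {v w : ℝ → ℝ}, MemLp v 2 (volume.restrict (Ioo a b)) →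
      MemLp w 2 (volume.restrict (Ioo a b)) →
      Integrable (fun x => v x * w x) (volume.restrict (Ioo a b)) := fun hv hw => hv.integrable_mul hw
  have hTV : ∀ w ∈ BV a b, - ∫ x in Ioo a b, w x * (u x - f x) ≤ weightedTV α w := by
    intro w hw
    have hr := isRep_D hab hw
    have hz1 := integrable_of_continuousOn_Icc hr.carried_left hZc
    have hz2 := integrable_of_continuousOn_Icc hr.carried_right hZc
    have ha1 := integrable_of_continuousOn_Icc hr.carried_left hα
    have ha2 := integrable_of_continuousOn_Icc hr.carried_right hα
    rw [hr.integral_mul hab hgi h.integral_eq_zero, weightedTV_eq hab hα hw]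
    have i1 : ∫ x, Z x ∂Dpos w ≤ ∫ x, α x ∂Dpos w := by
      refine integral_mono_ae hz1 ha1 ?_
      have : ∀ᵐ x ∂Dpos w, x ∈ Ioo a b := hr.carried_left
      filter_upwards [this] with x hx using (abs_le.1 (h.abs_primitive_le x hx)).2
    have i2 : ∫ x, - α x ∂Dneg w ≤ ∫ x, Z x ∂Dneg w := by
      refine integral_mono_ae ha2.neg hz2 ?_
      have : ∀ᵐ x ∂Dneg w, x ∈ Ioo a b := hr.carried_right
      filter_upwards [this] with x hx using (abs_le.1 (h.abs_primitive_le x hx)).1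
    rw [integral_neg] at i2
    linarith
  have hTVu : weightedTV α u = - ∫ x in Ioo a b, u x * (u x - f x) := by
    rw [hur.integral_mul hab hgi h.integral_eq_zero, weightedTV_eq hab hα hu,
      integral_congr_ae h.eq_pos, integral_congr_ae h.eq_neg, integral_neg]
    ring
  -- Keeping the quadratic remainder yields minimality and uniqueness from the same inequality.
  have key : ∀ w ∈ BV a b,
      energy α f u + 1 / 2 * ∫ x in Ioo a b, (u x - w x) ^ 2 ≤ energy α f w := by
    intro w hw
    have hwr := isRep_D hab hw
    have hfu : MemLp (fun x => f x - u x) 2 (volume.restrict (Ioo a b)) :=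
      (hfr.memLp 2).sub (hur.memLp 2)
    have huw : MemLp (fun x => u x - w x) 2 (volume.restrict (Ioo a b)) :=
      (hur.memLp 2).sub (hwr.memLp 2)
    have huf : MemLp (fun x => u x - f x) 2 (volume.restrict (Ioo a b)) :=
      (hur.memLp 2).sub (hfr.memLp 2)
    have e : ∫ x in Ioo a b, (f x - w x) ^ 2 = (∫ x in Ioo a b, (f x - u x) ^ 2)
        + (∫ x in Ioo a b, (u x - w x) ^ 2) - 2 * (∫ x in Ioo a b, u x * (u x - f x))
        + 2 * ∫ x in Ioo a b, w x * (u x - f x) := by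
      have i1 : Integrable (fun x => (f x - u x) ^ 2 + (u x - w x) ^ 2)
          (volume.restrict (Ioo a b)) := hfu.integrable_sq.add huw.integrable_sq
      have i2 := (hint (hur.memLp 2) huf).const_mul 2
      have i3 := (hint (hwr.memLp 2) huf).const_mul 2
      rw [← integral_const_mul, ← integral_const_mul, ← integral_add hfu.integrable_sq
        huw.integrable_sq, ← integral_sub i1 i2, ← integral_add (by exact i1.sub i2) i3]
      refine integral_congr_ae (Filter.Eventually.of_forall fun x => ?_)
      ring
    have := hTV w hw
    rw [energy, energy, hTVu, e]
    linarith
  have hnn : ∀ w : L1 a b, 0 ≤ ∫ x in Ioo a b, (u x - w x) ^ 2 := fun w =>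
    integral_nonneg fun x => sq_nonneg _
  ext w
  rw [mem_singleton_iff]
  constructor
  · rintro ⟨hw, hmin⟩
    have h1 := key w hw
    have h2 := hmin u hu
    have h0 : ∫ x in Ioo a b, (u x - w x) ^ 2 = 0 := le_antisymm (by linarith) (hnn w)
    have huw : MemLp (fun x => u x - w x) 2 (volume.restrict (Ioo a b)) :=
      (hur.memLp 2).sub ((isRep_D hab hw).memLp 2)
    rw [integral_eq_zero_iff_of_nonneg (fun x => sq_nonneg _) huw.integrable_sq] at h0
    refine Lp.ext ?_
    filter_upwards [h0] with x hx
    have : (u x - w x) ^ 2 = 0 := hx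
    have := pow_eq_zero_iff (two_ne_zero) |>.1 this
    linarith
  · rintro rfl
    exact ⟨hu, fun w' hw' => by linarith [key w' hw', hnn w']⟩

/-! ### Sign of the derivative on the contact set -/

theorem exists_contDiff_bump {C U : Set ℝ} (hC : IsCompact C) (hU : IsOpen U) (hCU : C ⊆ U) :
    ∃ η : ℝ → ℝ, ContDiff ℝ ∞ η ∧ HasCompactSupport η ∧ tsupport η ⊆ U ∧ (∀ x, 0 ≤ η x) ∧
      (∀ x, η x ≤ 1) ∧ ∀ x ∈ C, η x = 1 := by
  obtain ⟨L, hL, hCL, hLU⟩ := exists_compact_between hC hU hCU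
  obtain ⟨η, h0, h1, h01⟩ := exists_contMDiffMap_zero_one_of_isClosed (n := ⊤)
    (modelWithCornersSelf ℝ ℝ) (isOpen_interior (s := L)).isClosed_compl hC.isClosed
    (disjoint_compl_left_iff_subset.2 hCL)
  have hs : tsupport η ⊆ L :=
    closure_minimal (fun x hx => by_contra fun h => hx (h0 fun h' => h (interior_subset h')))
      hL.isClosed
  exact ⟨η, η.contMDiff.contDiff, hL.of_isClosed_subset (isClosed_tsupport _) hs, hs.trans hLU,
    fun x => (h01 x).1, fun x => (h01 x).2, fun x hx => h1 hx⟩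

/-- By regularity it suffices to compare `A` on a compact `C ⊆ E` with `B` on an open `U ⊇ C`; a
bump equal to `1` on `C` and supported in `U ∩ O` lies between the two indicators. -/
theorem measure_le_of_forall_contDiff {A B : Measure ℝ} [IsFiniteMeasure A] [IsFiniteMeasure B]
    {O : Set ℝ} (hO : IsOpen O)
    (h : ∀ η : ℝ → ℝ, ContDiff ℝ ∞ η → HasCompactSupport η → tsupport η ⊆ O → (∀ x, 0 ≤ η x) →
      (∀ x, η x ≤ 1) → ∫ x, η x ∂A ≤ ∫ x, η x ∂B)
    {E : Set ℝ} (hE : MeasurableSet E) (hEO : E ⊆ O) : A E ≤ B E := by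
  refine le_of_forall_lt fun r hr => ?_
  obtain ⟨C, hCE, hC, hrC⟩ := hE.exists_lt_isCompact hr
  refine hrC.trans_le (le_trans ?_ (measure_mono hCE))
  rw [C.measure_eq_iInf_isOpen B]
  refine le_iInf₂ fun U hCU => le_iInf fun hU => ?_
  obtain ⟨η, h1, h2, h3, h4, h5, h6⟩ :=
    exists_contDiff_bump hC (hU.inter hO) (subset_inter hCU (hCE.trans hEO))
  have hi : ∀ (Q : Measure ℝ) [IsFiniteMeasure Q], Integrable η Q :=
    fun Q _ => h1.continuous.integrable_of_hasCompactSupport h2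
  have e1 : A.real C ≤ ∫ x, η x ∂A := by
    rw [← integral_indicator_one hC.measurableSet]
    refine integral_mono ((integrable_const 1).indicator hC.measurableSet) (hi A) fun x => ?_
    by_cases hx : x ∈ C
    · simp [hx, h6 x hx]
    · simp [hx, h4 x]
  have e2 : ∫ x, η x ∂B ≤ B.real U := by
    rw [← integral_indicator_one hU.measurableSet]
    refine integral_mono (hi B) ((integrable_const 1).indicator hU.measurableSet) fun x => ?_
    by_cases hx : x ∈ U
    · simp [hx, h5 x]
    · simp [hx, image_eq_zero_of_notMem_tsupport fun hx' => hx (h3 hx').1]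
  have e3 := e1.trans ((h η h1 h2 (h3.trans inter_subset_right) h4 h5).trans e2)
  rwa [measureReal_def, measureReal_def,
    ENNReal.toReal_le_toReal (measure_ne_top _ _) (measure_ne_top _ _)] at e3

theorem continuousWithinAt_cdf (P : Measure ℝ) [IsFiniteMeasure P] (x : ℝ) :
    ContinuousWithinAt (fun y => P.real (Iic y)) (Ioi x) x := by
  have := tendsto_measure_biInter_gt (μ := P) (s := fun y : ℝ => Iic y) (a := x)
    (fun r _ => measurableSet_Iic.nullMeasurableSet) (fun i j _ hij => Iic_subset_Iic.2 hij)
    ⟨x + 1, by linarith, measure_ne_top _ _⟩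
  have e : ⋂ r > x, Iic r = Iic x := by
    ext y
    simp only [mem_iInter, mem_Iic]
    exact ⟨fun h => le_of_forall_gt_imp_ge_of_dense h, fun h r hr => h.trans hr.le⟩
  rw [e] at this
  exact (ENNReal.tendsto_toReal (measure_ne_top _ _)).comp this

theorem measurableSet_levelSet {a b : ℝ} {Z : ℝ → ℝ} (hZ : ContinuousOn Z (Icc a b)) (k : ℝ) :
    MeasurableSet {x | x ∈ Ioo a b ∧ Z x = k} := by
  have : {x | x ∈ Ioo a b ∧ Z x = k} = Ioo a b ∩ (Icc a b ∩ Z ⁻¹' {k}) := by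
    ext x
    exact ⟨fun h => ⟨h.1, Ioo_subset_Icc_self h.1, h.2⟩, fun h => ⟨h.1, h.2.2⟩⟩
  rw [this]
  exact measurableSet_Ioo.inter
    (hZ.preimage_isClosed_of_isClosed isClosed_Icc isClosed_singleton).measurableSet

/-- On the set where the primitive of `u` attains its maximum, `Du ≤ 0`. -/
theorem IsRep.measure_le_of_primitive_eq_max {a b : ℝ} (hab : a < b) {u : ℝ → ℝ}
    {A B : Measure ℝ} (h : IsRep a b u A B) {k : ℝ}
    (hk : ∀ x ∈ Ioo a b, ∫ t in a..x, u t ≤ k) {E : Set ℝ} (hE : MeasurableSet E)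
    (hEk : ∀ x ∈ E, x ∈ Ioo a b ∧ ∫ t in a..x, u t = k) : A E ≤ B E := by
  obtain ⟨_, _, hA, hB, c, hc⟩ := h
  -- This representative is right-continuous, so its primitive has right derivative `v` at every
  -- point, not only almost everywhere.
  set v : ℝ → ℝ := fun x => c + A.real (Iic x) - B.real (Iic x) with hv
  have hvm : Measurable v := ((measurable_cdf A).const_add c).sub (measurable_cdf B)
  have hvb : ∀ x, ‖v x‖ ≤ |c| + A.real univ + B.real univ := by
    intro x
    have h1 : A.real (Iic x) ≤ A.real univ := measureReal_mono (subset_univ _)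
    have h2 : B.real (Iic x) ≤ B.real univ := measureReal_mono (subset_univ _)
    have h3 : 0 ≤ A.real (Iic x) := measureReal_nonneg
    have h4 : 0 ≤ B.real (Iic x) := measureReal_nonneg
    rw [Real.norm_eq_abs, abs_le]
    constructor <;> cases abs_cases c <;> simp only [hv] <;> linarith
  have hvr : IsRep a b v A B := ⟨inferInstance, inferInstance, hA, hB, c, .rfl⟩
  have hv1 : IntegrableOn v (Icc a b) :=
    Measure.integrableOn_of_bounded (by simp) hvm.aestronglyMeasurable
      (Filter.Eventually.of_forall hvb)
  have hv2 : IntegrableOn (fun x => v x * v x) (Icc a b) :=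
    hv1.mul_bdd hvm.aestronglyMeasurable (Filter.Eventually.of_forall hvb)
  have hvi : ∀ x y, IntervalIntegrable v volume x y := fun x y =>
    (intervalIntegrable_const (c := |c| + A.real univ + B.real univ)).mono_fun
      hvm.aestronglyMeasurable (Filter.Eventually.of_forall fun x =>
        (hvb x).trans (le_abs_self _))
  set Z : ℝ → ℝ := fun x => ∫ t in a..x, v t with hZ
  have huZ : ∀ x ∈ Ioo a b, ∫ t in a..x, u t = Z x := by
    intro x hx
    refine intervalIntegral.integral_congr_ae ?_
    rw [Filter.EventuallyEq, ae_restrict_iff' measurableSet_Ioo] at hc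
    filter_upwards [hc] with t ht ht'
    rw [uIoc_of_le hx.1.le] at ht'
    exact ht ⟨ht'.1, ht'.2.trans_lt hx.2⟩
  have hZk : ∀ x ∈ Ioo a b, Z x ≤ k := fun x hx => huZ x hx ▸ hk x hx
  have hZc : Continuous Z := intervalIntegral.continuous_primitive hvi a
  have hZd : ∀ x, HasDerivWithinAt Z (v x) (Ioi x) x := fun x =>
    (intervalIntegral.integral_hasDerivWithinAt_right (s := Ici x) (t := Ioi x) (hvi a x)
      hvm.stronglyMeasurable.stronglyMeasurableAtFilter
      ((continuousWithinAt_const.add (continuousWithinAt_cdf A x)).sub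
        (continuousWithinAt_cdf B x))).mono Ioi_subset_Ici_self
  set K : Set ℝ := {x | x ∈ Ioo a b ∧ Z x = k} with hK
  have hKm : MeasurableSet K := measurableSet_levelSet hZc.continuousOn k
  have hEK : E ⊆ K := fun x hx => ⟨(hEk x hx).1, huZ x (hEk x hx).1 ▸ (hEk x hx).2⟩
  -- Almost every point of `K` is an interior maximum at which `Z` has derivative `v`.
  have hvK : ∀ᵐ x, x ∈ K → v x = 0 := by
    filter_upwards [(hvi a b).ae_hasDerivAt_integral] with x hx hxK
    have hd := hx (by rw [uIcc_of_le hab.le]; exact Ioo_subset_Icc_self hxK.1) a left_mem_uIcc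
    refine IsLocalMax.hasDerivAt_eq_zero ?_ hd
    filter_upwards [Ioo_mem_nhds hxK.1.1 hxK.1.2] with y hy
    exact (hZk y hy).trans_eq hxK.2.symm
  suffices H : A.restrict K E ≤ B.restrict K E by
    rwa [Measure.restrict_apply hE, Measure.restrict_apply hE, inter_eq_left.2 hEK] at H
  refine measure_le_of_forall_contDiff isOpen_Ioo (fun η h1 h2 h3 h4 h5 => ?_) hE
    (fun x hx => (hEk x hx).1)
  have hη0 : ∀ x, x ∉ Ioo a b → η x = 0 := fun x hx =>
    image_eq_zero_of_notMem_tsupport fun h => hx (h3 h)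
  have hηd : Continuous (deriv η) := h1.continuous_deriv (by simp)
  have hη' : ∀ x, HasDerivAt η (deriv η x) x := fun x =>
    (h1.differentiable (by simp)).differentiableAt.hasDerivAt
  -- Since `Z ≤ k` with equality exactly on `K`, these weights are at most `1` and converge on `(a,
  -- b)` to the indicator of `K`.
  set e : ℕ → ℝ → ℝ := fun n x => Real.exp (n * (Z x - k)) with he
  have hec : ∀ n, Continuous (e n) := fun n => by fun_prop
  have he1 : ∀ n, ∀ x ∈ Ioo a b, e n x ≤ 1 := fun n x hx =>
    Real.exp_le_one_iff.2 (mul_nonpos_of_nonneg_of_nonpos n.cast_nonneg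
      (sub_nonpos.2 (hZk x hx)))
  have het : ∀ x ∈ Ioo a b, Filter.Tendsto (fun n => e n x) Filter.atTop
      (nhds (K.indicator (fun _ => 1) x)) := by
    intro x hx
    by_cases hxK : x ∈ K
    · simp [he, hxK, hxK.2]
    · have hlt : Z x - k < 0 := sub_neg.2 (lt_of_le_of_ne (hZk x hx) fun h => hxK ⟨hx, h⟩)
      rw [indicator_of_notMem hxK]
      exact Real.tendsto_exp_atBot.comp
        (tendsto_natCast_atTop_atTop.atTop_mul_const_of_neg hlt)
  -- The right derivative of `η e_n`; its second summand, once multiplied by `v`, is `n η e_n v² ≥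
  -- 0`.
  set g : ℕ → ℝ → ℝ := fun n x => deriv η x * e n x + η x * (n * e n x * v x) with hg
  have hgi : ∀ n, IntervalIntegrable (g n) volume a b := by
    intro n
    refine ((hηd.mul (hec n)).intervalIntegrable a b).add ?_
    have : ContinuousOn (fun x => η x * (n * e n x)) (uIcc a b) :=
      (h1.continuous.mul (continuous_const.mul (hec n))).continuousOn
    refine ((hvi a b).continuousOn_mul this).congr (fun x _ => ?_)
    ring
  have hφ : ∀ n, ∀ t ∈ Icc a b, ∫ x in a..t, g n x = η t * e n t := by
    intro n t ht
    rw [intervalIntegral.integral_eq_sub_of_hasDeriv_right_of_le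
      (f := fun x => η x * e n x) ht.1 (h1.continuous.mul (hec n)).continuousOn]
    · simp [hη0 a (fun h => h.1.ne rfl)]
    · intro x hx
      have := (hη' x).hasDerivWithinAt.mul
        (((hZd x).sub_const k).const_mul (n : ℝ)).exp
      refine this.congr_deriv ?_
      simp only [hg, he]; ring
    · exact (hgi n).mono_set (by
        rw [uIcc_of_le ht.1, uIcc_of_le hab.le]; exact Icc_subset_Icc_right ht.2)
  -- Integration by parts against `g n` gives the right-hand side; discarding `n η e_n v²` leaves an
  -- inequality whose left-hand side tends to `0`, because `e_n → 0` off `K` and `v = 0` almost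
  -- everywhere on `K`.
  have hle : ∀ n, ∫ x in Ioo a b, v x * deriv η x * e n x
      ≤ ∫ x, η x * e n x ∂B - ∫ x, η x * e n x ∂A := by
    intro n
    have hz : ∀ (Q : Measure ℝ), Q (Ioo a b)ᶜ = 0 →
        ∫ t, (∫ x in a..t, g n x) ∂Q = ∫ t, η t * e n t ∂Q := by
      intro Q hQ
      have hQ' : ∀ᵐ x ∂Q, x ∈ Ioo a b := hQ
      refine integral_congr_ae ?_
      filter_upwards [hQ'] with t ht using hφ n t (Ioo_subset_Icc_self ht)
    have hi := hvr.integral_mul hab (hgi n) (by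
      rw [hφ n b (right_mem_Icc.2 hab.le), hη0 b (fun h => h.2.ne rfl), zero_mul])
    rw [hz A hA, hz B hB] at hi
    rw [← hi]
    have i1 : IntegrableOn (fun x => v x * deriv η x * e n x) (Icc a b) :=
      (hv1.mul_continuousOn (hηd.mul (hec n)).continuousOn isCompact_Icc).congr_fun
        (fun x _ => by simp only [Pi.mul_apply]; ring) measurableSet_Icc
    have i2 : IntegrableOn (fun x => v x * g n x) (Icc a b) := by
      have := hv2.mul_continuousOn (h1.continuous.mul
        (continuous_const.mul (hec n) : Continuous fun x => (n : ℝ) * e n x)).continuousOn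
        isCompact_Icc
      refine (i1.add this).congr_fun (fun x _ => ?_) measurableSet_Icc
      simp only [hg, Pi.add_apply, Pi.mul_apply]; ring
    refine integral_mono (i1.mono_set Ioo_subset_Icc_self) (i2.mono_set Ioo_subset_Icc_self)
      fun x => ?_
    have : 0 ≤ η x * (n * e n x * (v x * v x)) :=
      mul_nonneg (h4 x) (mul_nonneg (mul_nonneg n.cast_nonneg (Real.exp_pos _).le)
        (mul_self_nonneg _))
    simp only [hg]
    linarith
  have hlim : ∀ (Q : Measure ℝ) [IsFiniteMeasure Q], Q (Ioo a b)ᶜ = 0 →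
      Filter.Tendsto (fun n => ∫ x, η x * e n x ∂Q) Filter.atTop (nhds (∫ x in K, η x ∂Q)) := by
    intro Q _ hQ
    have hQ' : ∀ᵐ x ∂Q, x ∈ Ioo a b := hQ
    rw [← integral_indicator hKm]
    refine tendsto_integral_of_dominated_convergence (fun _ => 1)
      (fun n => (h1.continuous.mul (hec n)).aestronglyMeasurable) (integrable_const 1) ?_ ?_
    · intro n
      filter_upwards [hQ'] with x hx
      rw [Real.norm_of_nonneg (mul_nonneg (h4 x) (Real.exp_pos _).le)]
      exact mul_le_one₀ (h5 x) (Real.exp_pos _).le (he1 n x hx)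
    · filter_upwards [hQ'] with x hx
      have := (het x hx).const_mul (η x)
      convert this using 2
      by_cases hxK : x ∈ K <;> simp [hxK]
  have hlim0 : Filter.Tendsto (fun n => ∫ x in Ioo a b, v x * deriv η x * e n x) Filter.atTop
      (nhds (∫ x in Ioo a b, (0 : ℝ))) := by
    refine tendsto_integral_of_dominated_convergence (fun x => ‖v x * deriv η x‖)
      (fun n => ((hvm.mul hηd.measurable).mul (hec n).measurable).aestronglyMeasurable)
      (((hv1.mul_continuousOn hηd.continuousOn isCompact_Icc).mono_set
        Ioo_subset_Icc_self).norm) ?_ ?_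
    · intro n
      filter_upwards [ae_restrict_mem measurableSet_Ioo] with x hx
      rw [norm_mul]
      refine mul_le_of_le_one_right (norm_nonneg _) ?_
      rw [Real.norm_of_nonneg (Real.exp_pos _).le]
      exact he1 n x hx
    · filter_upwards [ae_restrict_mem measurableSet_Ioo, ae_restrict_of_ae hvK] with x hx hxv
      have := (het x hx).const_mul (v x * deriv η x)
      convert this using 2
      by_cases hxK : x ∈ K <;> simp [hxK, hxv]
  have := le_of_tendsto_of_tendsto' hlim0 ((hlim B hB).sub (hlim A hA)) hle
  simp only [integral_zero] at this
  linarith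

/-- For a constant weight, `(Du)⁺ ≪ (Df)⁺`. -/
theorem IsCert.Dpos_absolutelyContinuous {a b : ℝ} (hab : a < b) {k : ℝ} (hk : 0 < k)
    {f u : L1 a b} (hf : f ∈ BV a b) (h : IsCert (fun _ => k) f u) : Dpos u ≪ Dpos f := by
  refine Measure.AbsolutelyContinuous.mk fun E hE hE0 => ?_
  have hur := isRep_D hab h.mem_BV
  have hfr := isRep_D hab hf
  have hZ := continuousOn_primitive hab (intervalIntegrable_sub hab u f)
  set K : Set ℝ := {x | x ∈ Ioo a b ∧ ∫ t in a..x, (u t - f t) = k} with hK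
  have hKm : MeasurableSet K := measurableSet_levelSet hZ k
  have h1 : Dpos u Kᶜ = 0 := by
    have hI : ∀ᵐ x ∂Dpos u, x ∈ Ioo a b := hur.carried_left
    rw [← mem_ae_iff]
    filter_upwards [hI, h.eq_pos] with x hx hx' using ⟨hx, hx'⟩
  -- `(Du)⁻` lives on the level `-k`, which differs from `k` because `k > 0`.
  have h2 : Dneg u K = 0 := by
    rw [measure_eq_zero_iff_ae_notMem]
    filter_upwards [h.eq_neg] with x hx hxK
    linarith [hxK.2]
  -- On the contact set this reads `(Du)⁺ + (Df)⁻ ≤ (Du)⁻ + (Df)⁺`, and both terms on the right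
  -- vanish on `E ∩ K`.
  have h3 := (hur.sub hfr).measure_le_of_primitive_eq_max hab (k := k)
    (fun x hx => (abs_le.1 (h.abs_primitive_le x hx)).2) (hE.inter hKm) (fun x hx => hx.2)
  rw [Measure.add_apply, Measure.add_apply, measure_mono_null inter_subset_right h2,
    measure_mono_null inter_subset_left hE0, zero_add] at h3
  have h4 : Dpos u (E ∩ K) = 0 := le_antisymm (le_self_add.trans h3) bot_le
  refine measure_mono_null (t := E ∩ K ∪ Kᶜ) (fun x hx => ?_) (measure_union_null h4 h1)
  by_cases hxK : x ∈ K
  · exact Or.inl ⟨hx, hxK⟩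
  · exact Or.inr hxK

/-- For a constant weight, `(Du)⁻ ≪ (Df)⁻`. -/
theorem IsCert.Dneg_absolutelyContinuous {a b : ℝ} (hab : a < b) {k : ℝ} (hk : 0 < k)
    {f u : L1 a b} (hf : f ∈ BV a b) (h : IsCert (fun _ => k) f u) : Dneg u ≪ Dneg f := by
  refine Measure.AbsolutelyContinuous.mk fun E hE hE0 => ?_
  have hur := isRep_D hab h.mem_BV
  have hfr := isRep_D hab hf
  have hZ := continuousOn_primitive hab (intervalIntegrable_sub hab u f)
  set K : Set ℝ := {x | x ∈ Ioo a b ∧ ∫ t in a..x, (u t - f t) = -k} with hK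
  have hKm : MeasurableSet K := measurableSet_levelSet hZ (-k)
  have h1 : Dneg u Kᶜ = 0 := by
    have hI : ∀ᵐ x ∂Dneg u, x ∈ Ioo a b := hur.carried_right
    rw [← mem_ae_iff]
    filter_upwards [hI, h.eq_neg] with x hx hx' using ⟨hx, hx'⟩
  have h2 : Dpos u K = 0 := by
    rw [measure_eq_zero_iff_ae_notMem]
    filter_upwards [h.eq_pos] with x hx hxK
    linarith [hxK.2]
  have hneg : ∀ x, ∫ t in a..x, (-(u - f : ℝ → ℝ)) t = - ∫ t in a..x, (u t - f t) := fun x => by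
    rw [← intervalIntegral.integral_neg]; rfl
  have h3 := (hur.sub hfr).neg.measure_le_of_primitive_eq_max hab (k := k)
    (fun x hx => by rw [hneg]; linarith [(abs_le.1 (h.abs_primitive_le x hx)).1]) (hE.inter hKm)
    (fun x hx => ⟨hx.2.1, by rw [hneg, hx.2.2, neg_neg]⟩)
  rw [Measure.add_apply, Measure.add_apply, measure_mono_null inter_subset_right h2,
    measure_mono_null inter_subset_left hE0, zero_add] at h3
  have h4 : Dneg u (E ∩ K) = 0 := le_antisymm (le_self_add.trans h3) bot_le
  refine measure_mono_null (t := E ∩ K ∪ Kᶜ) (fun x hx => ?_) (measure_union_null h4 h1)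
  by_cases hxK : x ∈ K
  · exact Or.inl ⟨hx, hxK⟩
  · exact Or.inr hxK

/-- The constant-weight step creates no new support for the positive or negative part of the
derivative, so contact conditions known almost everywhere for `Du` pass to `Dw` and the two
equalities add. -/
theorem IsCert.comp {a b : ℝ} (hab : a < b) {α : ℝ → ℝ} {k : ℝ} (hk : 0 < k) {f u w : L1 a b}
    (hu : IsCert α f u) (hw : IsCert (fun _ => k) u w) :
    IsCert (fun x => α x + k) f w := by
  have hadd : ∀ x ∈ Icc a b, ∫ t in a..x, (w t - f t)
      = (∫ t in a..x, (u t - f t)) + ∫ t in a..x, (w t - u t) := by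
    intro x hx
    have hs : uIcc a x ⊆ uIcc a b := by
      rw [uIcc_of_le hx.1, uIcc_of_le hab.le]; exact Icc_subset_Icc_right hx.2
    rw [← intervalIntegral.integral_add ((intervalIntegrable_sub hab u f).mono_set hs)
      ((intervalIntegrable_sub hab w u).mono_set hs)]
    exact intervalIntegral.integral_congr fun t _ => by ring
  have hwr := isRep_D hab hw.mem_BV
  refine ⟨hw.mem_BV, ?_, fun x hx => ?_, ?_, ?_⟩
  · rw [hadd b (right_mem_Icc.2 hab.le), hu.integral_eq_zero, hw.integral_eq_zero, add_zero]
  · rw [hadd x (Ioo_subset_Icc_self hx)]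
    exact (abs_add_le _ _).trans (add_le_add (hu.abs_primitive_le x hx) (hw.abs_primitive_le x hx))
  · have hI : ∀ᵐ x ∂Dpos w, x ∈ Ioo a b := hwr.carried_left
    filter_upwards [hI, hw.eq_pos,
      (hw.Dpos_absolutelyContinuous hab hk hu.mem_BV).ae_le hu.eq_pos] with x hx h1 h2
    rw [hadd x (Ioo_subset_Icc_self hx), h1, h2]
  · have hI : ∀ᵐ x ∂Dneg w, x ∈ Ioo a b := hwr.carried_right
    filter_upwards [hI, hw.eq_neg,
      (hw.Dneg_absolutelyContinuous hab hk hu.mem_BV).ae_le hu.eq_neg] with x hx h1 h2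
    rw [hadd x (Ioo_subset_Icc_self hx), h1, h2]
    ring

/-! ### The dual problem -/

/-- The convex set of the dual problem: square integrable functions with vanishing mean whose
primitive is bounded by the weight. -/
structure IsAdmissible (a b : ℝ) (α q : ℝ → ℝ) : Prop where
  memLp : MemLp q 2 (volume.restrict (Ioo a b))
  integral_eq_zero : ∫ x in a..b, q x = 0
  abs_primitive_le : ∀ x ∈ Ioo a b, |∫ t in a..x, q t| ≤ α x

theorem IsAdmissible.intervalIntegrable {a b : ℝ} (hab : a < b) {α q : ℝ → ℝ}
    (h : IsAdmissible a b α q) : IntervalIntegrable q volume a b :=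
  (intervalIntegrable_iff_integrableOn_Ioo_of_le hab.le).2
    (h.memLp.integrable (by norm_num))

theorem IsAdmissible.neg {a b : ℝ} {α q : ℝ → ℝ} (h : IsAdmissible a b α q) :
    IsAdmissible a b α (-q) := by
  refine ⟨h.memLp.neg, ?_, fun x hx => ?_⟩
  · simp [h.integral_eq_zero]
  · simpa using h.abs_primitive_le x hx

theorem setIntegral_Ioc_restrict_Ioo {a b x : ℝ} (hx : x ∈ Icc a b) (q : ℝ → ℝ) :
    ∫ t in Ioc a x, q t ∂(volume.restrict (Ioo a b)) = ∫ t in a..x, q t := by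
  rw [intervalIntegral.integral_of_le hx.1, restrict_Ioo_eq_restrict_Ioc,
    Measure.restrict_restrict measurableSet_Ioc, inter_eq_left.2 (Ioc_subset_Ioc_right hx.2)]

theorem exists_isAdmissible_projection {a b : ℝ} (hab : a < b) {α f : ℝ → ℝ}
    (hα : ∀ x ∈ Ioo a b, 0 ≤ α x) (hf : MemLp f 2 (volume.restrict (Ioo a b))) :
    ∃ p, IsAdmissible a b α p ∧ ∀ q, IsAdmissible a b α q →
      ∫ x in Ioo a b, (f x - p x) * q x ≤ ∫ x in Ioo a b, (f x - p x) * p x := by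
  set m : Measure ℝ := volume.restrict (Ioo a b) with hm
  -- Primitives are inner products with indicators of `(a, x]`, so the constraints are closed and
  -- convex in `L²`.
  let ℓ : ℝ → Lp ℝ 2 m → ℝ := fun x q =>
    inner ℝ (indicatorConstLp 2 (measurableSet_Ioc (a := a) (b := x)) (measure_ne_top m _) (1 : ℝ)) q
  have hℓ : ∀ x ∈ Icc a b, ∀ q : Lp ℝ 2 m, ℓ x q = ∫ t in a..x, q t := by
    intro x hx q
    rw [← setIntegral_Ioc_restrict_Ioo hx]
    exact L2.inner_indicatorConstLp_one measurableSet_Ioc (measure_ne_top m _) q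
  have hℓc : ∀ x, Continuous (ℓ x) := fun x => continuous_const.inner continuous_id
  set K : Set (Lp ℝ 2 m) := {q | ℓ b q = 0} ∩ ⋂ x ∈ Ioo a b, {q | |ℓ x q| ≤ α x} with hK
  have hKa : ∀ q : Lp ℝ 2 m, q ∈ K ↔ IsAdmissible a b α q := by
    intro q
    constructor
    · rintro ⟨h1, h2⟩
      simp only [mem_iInter] at h2
      refine ⟨Lp.memLp q, ?_, fun x hx => ?_⟩
      · rw [← hℓ b (right_mem_Icc.2 hab.le)]; exact h1
      · rw [← hℓ x (Ioo_subset_Icc_self hx)]; exact h2 x hx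
    · intro h
      refine ⟨?_, mem_iInter₂.2 fun x hx => ?_⟩
      · rw [mem_ofPred, hℓ b (right_mem_Icc.2 hab.le)]; exact h.integral_eq_zero
      · rw [mem_ofPred, hℓ x (Ioo_subset_Icc_self hx)]; exact h.abs_primitive_le x hx
  have hKc : IsClosed K := by
    refine (isClosed_eq (hℓc b) continuous_const).inter (isClosed_biInter fun x _ => ?_)
    exact isClosed_le (hℓc x).abs continuous_const
  have hKv : Convex ℝ K := by
    intro q hq r hr s t hs ht hst
    have hlin : ∀ x, ℓ x (s • q + t • r) = s * ℓ x q + t * ℓ x r := fun x => by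
      simp only [ℓ, inner_add_right, real_inner_smul_right]
    have hq2 := mem_iInter₂.1 hq.2
    have hr2 := mem_iInter₂.1 hr.2
    refine ⟨?_, mem_iInter₂.2 fun x hx => ?_⟩
    · have h1 : ℓ b q = 0 := hq.1
      have h2 : ℓ b r = 0 := hr.1
      rw [mem_ofPred, hlin, h1, h2]; ring
    · rw [mem_ofPred, hlin]
      calc |s * ℓ x q + t * ℓ x r| ≤ |s * ℓ x q| + |t * ℓ x r| := abs_add_le _ _
        _ = s * |ℓ x q| + t * |ℓ x r| := by rw [abs_mul, abs_mul, abs_of_nonneg hs, abs_of_nonneg ht]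
        _ ≤ s * α x + t * α x := by gcongr; exacts [hq2 x hx, hr2 x hx]
        _ = α x := by rw [← add_mul, hst, one_mul]
  have hK0 : K.Nonempty := by
    refine ⟨0, ?_, mem_iInter₂.2 fun x hx => ?_⟩
    · simp [ℓ]
    · simpa [ℓ] using hα x hx
  obtain ⟨p, hpK, hp⟩ := exists_norm_eq_iInf_of_complete_convex hK0 hKc.isComplete hKv (hf.toLp f)
  rw [norm_eq_iInf_iff_real_inner_le_zero hKv hpK] at hp
  refine ⟨p, (hKa p).1 hpK, fun q hq => ?_⟩
  have hpL : MemLp p 2 m := Lp.memLp p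
  have hqK : hq.memLp.toLp q ∈ K := by
    rw [hKa]
    have hc : ∀ x ∈ Icc a b, ∫ t in a..x, hq.memLp.toLp q t = ∫ t in a..x, q t := by
      intro x hx
      rw [← setIntegral_Ioc_restrict_Ioo hx, ← setIntegral_Ioc_restrict_Ioo hx]
      exact integral_congr_ae (ae_restrict_of_ae hq.memLp.coeFn_toLp)
    refine ⟨Lp.memLp _, ?_, fun x hx => ?_⟩
    · rw [hc b (right_mem_Icc.2 hab.le), hq.integral_eq_zero]
    · rw [hc x (Ioo_subset_Icc_self hx)]; exact hq.abs_primitive_le x hx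
  have h := hp _ hqK
  rw [L2.inner_def] at h
  have e : ∫ x, inner ℝ ((hf.toLp f - p : Lp ℝ 2 m) x) ((hq.memLp.toLp q - p : Lp ℝ 2 m) x) ∂m
      = ∫ x, ((f x - p x) * q x - (f x - p x) * p x) ∂m := by
    refine integral_congr_ae ?_
    filter_upwards [Lp.coeFn_sub (hf.toLp f) p, Lp.coeFn_sub (hq.memLp.toLp q) p,
      hf.coeFn_toLp, hq.memLp.coeFn_toLp] with x h1 h2 h3 h4
    rw [h1, h2, Pi.sub_apply, Pi.sub_apply, h3, h4]
    simp only [inner]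
    simp; ring
  have i1 : Integrable (fun x => (f x - p x) * q x) m := (hf.sub hpL).integrable_mul hq.memLp
  have i2 : Integrable (fun x => (f x - p x) * p x) m := (hf.sub hpL).integrable_mul hpL
  rw [e, integral_sub i1 i2] at h
  linarith

/-! ### Bounded variation from the dual bound -/

theorem integral_indicator_Ioc_eq {a x y h : ℝ} (hx : a ≤ x) (hy : a ≤ y) :
    ∫ t in a..x, (Ioc y (y + h)).indicator (fun _ => (1 : ℝ)) t = max (min (x - y) h) 0 := by
  rw [intervalIntegral.integral_of_le hx, setIntegral_indicator measurableSet_Ioc,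
    Ioc_inter_Ioc, sup_eq_right.2 hy, setIntegral_const, Real.volume_real_Ioc, smul_eq_mul, mul_one]
  congr 1
  rcases min_cases x (y + h) with h' | h' <;> rcases min_cases (x - y) h with h'' | h'' <;> linarith

/-- On `T`, `u` is a difference of two bounded monotone functions. These extend monotonically to the
line, and their right-continuous versions, which change only countably many values, define Stieltjes
measures. -/
theorem isRep_of_boundedVariationOn {a b : ℝ} (hab : a < b) {u : ℝ → ℝ} {T : Set ℝ}
    (hT : ∀ᵐ x ∂volume.restrict (Ioo a b), x ∈ T) (h : BoundedVariationOn u T) :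
    ∃ P N, IsRep a b u P N := by
  obtain ⟨c, hc⟩ : T.Nonempty := by
    have : (volume.restrict (Ioo a b)) ≠ 0 := by simp [Measure.restrict_eq_zero, hab]
    have := ae_neBot.2 this
    exact hT.exists
  set g₁ : ℝ → ℝ := variationOnFromTo u T c with hg₁
  have hb₁ : ∀ x, |g₁ x| ≤ (eVariationOn u T).toReal := fun x =>
    variationOnFromTo.abs_le_eVariationOn h
  have hb₂ : ∀ x ∈ T, |g₁ x - u x| ≤ |u c| + 2 * (eVariationOn u T).toReal := by
    intro x hx
    have h1 := h.dist_le hx hc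
    rw [Real.dist_eq] at h1
    have h2 := hb₁ x
    calc |g₁ x - u x| = |g₁ x - (u x - u c) - u c| := by ring_nf
      _ ≤ |g₁ x| + |u x - u c| + |u c| :=
        (abs_sub _ _).trans (add_le_add_left (abs_sub _ _) _)
      _ ≤ _ := by linarith
  have hbdd : ∀ (g : ℝ → ℝ) (C : ℝ), (∀ x ∈ T, |g x| ≤ C) → BddBelow (g '' T) ∧ BddAbove (g '' T) := by
    intro g C hC
    constructor
    · exact ⟨-C, by rintro _ ⟨x, hx, rfl⟩; exact (abs_le.1 (hC x hx)).1⟩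
    · exact ⟨C, by rintro _ ⟨x, hx, rfl⟩; exact (abs_le.1 (hC x hx)).2⟩
  have hl := h.locallyBoundedVariationOn
  obtain ⟨G₁, hG₁m, hG₁⟩ := (variationOnFromTo.monotoneOn hl hc).exists_monotone_extension
    (hbdd _ _ fun x _ => hb₁ x).1 (hbdd _ _ fun x _ => hb₁ x).2
  obtain ⟨G₂, hG₂m, hG₂⟩ := (variationOnFromTo.sub_self_monotoneOn hl hc).exists_monotone_extension
    (hbdd _ _ hb₂).1 (hbdd _ _ hb₂).2
  set F₁ := hG₁m.stieltjesFunction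
  set F₂ := hG₂m.stieltjesFunction
  have hae : ∀ {G : ℝ → ℝ} (hG : Monotone G), ∀ᵐ x, hG.stieltjesFunction x = G x := by
    intro G hG
    filter_upwards [hG.countable_not_continuousAt.ae_notMem volume] with x hx
    rw [hG.stieltjesFunction_eq]
    simp only [not_not] at hx
    exact hx.continuousWithinAt.rightLim_eq
  have hcdf : ∀ F : StieltjesFunction ℝ, ∀ x ∈ Ioo a b,
      (F.measure.restrict (Ioo a b)).real (Iic x) = F x - F a := by
    intro F x hx
    rw [measureReal_restrict_apply measurableSet_Iic,
      show Iic x ∩ Ioo a b = Ioc a x by ext t; simp; grind, measureReal_def, F.measure_Ioc,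
      ENNReal.toReal_ofReal (sub_nonneg.2 (F.mono hx.1.le))]
  have hfin : ∀ F : StieltjesFunction ℝ, IsFiniteMeasure (F.measure.restrict (Ioo a b)) :=
    fun F => ⟨by rw [Measure.restrict_apply_univ, F.measure_Ioo]; exact ENNReal.ofReal_lt_top⟩
  have hcar : ∀ F : StieltjesFunction ℝ, (F.measure.restrict (Ioo a b)) (Ioo a b)ᶜ = 0 :=
    fun F => by rw [Measure.restrict_apply measurableSet_Ioo.compl]; simp
  refine ⟨F₁.measure.restrict (Ioo a b), F₂.measure.restrict (Ioo a b), hfin _, hfin _, hcar _,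
    hcar _, F₁ a - F₂ a, ?_⟩
  filter_upwards [hT, ae_restrict_of_ae (hae hG₁m), ae_restrict_of_ae (hae hG₂m),
    ae_restrict_mem measurableSet_Ioo] with x h1 h2 h3 h4
  rw [hcdf _ x h4, hcdf _ x h4]
  have e1 := hG₁ h1
  have e2 := hG₂ h1
  simp only [Pi.sub_apply] at e2
  simp only [F₁, F₂] at h2 h3 ⊢
  rw [h2, h3]
  linarith

/-- Pairing `u` with signed, normalised indicators of `(x i, x i + h]` gives differences of
difference quotients of the primitive, which tend to the differences of `u` as `h → 0`. -/
theorem sum_abs_sub_le_of_forall_isAdmissible {a b : ℝ} (hab : a < b) {u : ℝ → ℝ}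
    (hu : IntervalIntegrable u volume a b) {δ M : ℝ} (hδ : 0 < δ)
    (hM : ∀ q, IsAdmissible a b (fun _ => δ) q → ∫ t in Ioo a b, u t * q t ≤ M)
    {x : ℕ → ℝ} (hx : Monotone x) (hxm : ∀ i, x i ∈ Ioo a b)
    (hxd : ∀ i, HasDerivAt (fun y => ∫ t in a..y, u t) (u (x i)) (x i)) (n : ℕ) :
    ∑ i ∈ Finset.range n, |u (x (i + 1)) - u (x i)| ≤ M / δ := by
  set U : ℝ → ℝ := fun y => ∫ t in a..y, u t with hU
  obtain ⟨s, hs1, hs⟩ : ∃ s : ℕ → ℝ, (∀ i, |s i| ≤ 1) ∧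
      ∀ i, s i * (u (x (i + 1)) - u (x i)) = |u (x (i + 1)) - u (x i)| := by
    refine ⟨fun i => if 0 ≤ u (x (i + 1)) - u (x i) then 1 else -1, fun i => ?_, fun i => ?_⟩
    · simp only
      split_ifs <;> simp
    · simp only
      split_ifs with h
      · rw [abs_of_nonneg h, one_mul]
      · rw [abs_of_neg (not_le.1 h)]; ring
  have hlim : Filter.Tendsto (fun h : ℝ => ∑ i ∈ Finset.range n,
      s i * (h⁻¹ • (U (x (i + 1) + h) - U (x (i + 1))) - h⁻¹ • (U (x i + h) - U (x i))))
      (nhdsWithin 0 (Ioi 0)) (nhds (∑ i ∈ Finset.range n, |u (x (i + 1)) - u (x i)|)) := by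
    simp_rw [← hs]
    exact tendsto_finsetSum _ fun i _ => ((hxd (i + 1)).tendsto_slope_zero_right.sub
      (hxd i).tendsto_slope_zero_right).const_mul (s i)
  refine le_of_tendsto hlim ?_
  -- For `h < b - x n` all the intervals `(x i, x i + h]` with `i ≤ n` stay inside `(a, b)`.
  filter_upwards [Ioo_mem_nhdsGT (sub_pos.2 (hxm n).2)] with h hh
  have h0 : 0 < h := hh.1
  have hxb : ∀ i ≤ n, x i + h < b := fun i hi => by linarith [hx hi, hh.2]
  set J : ℕ → ℝ → ℝ := fun i => (Ioc (x i) (x i + h)).indicator fun _ => 1 with hJ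
  set R : ℕ → ℝ → ℝ := fun i y => max (min (y - x i) h) 0 with hR
  set q : ℝ → ℝ := fun t => ∑ i ∈ Finset.range n, δ * s i * h⁻¹ * (J (i + 1) t - J i t) with hq
  have hJi : ∀ i c d, IntervalIntegrable (J i) volume c d := fun i c d =>
    ((integrable_indicator_iff measurableSet_Ioc).2
      (integrableOn_const (by simp))).intervalIntegrable
  have hprim : ∀ y ∈ Icc a b, ∫ t in a..y, q t
      = ∑ i ∈ Finset.range n, δ * s i * h⁻¹ * (R (i + 1) y - R i y) := by
    intro y hy
    rw [hq, intervalIntegral.integral_finsetSum fun i _ => ((hJi _ _ _).sub (hJi _ _ _)).const_mul _]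
    refine Finset.sum_congr rfl fun i _ => ?_
    rw [intervalIntegral.integral_const_mul, intervalIntegral.integral_sub (hJi _ _ _) (hJi _ _ _),
      hJ, integral_indicator_Ioc_eq hy.1 (hxm _).1.le, integral_indicator_Ioc_eq hy.1 (hxm _).1.le]
  have hadm : IsAdmissible a b (fun _ => δ) q := by
    refine ⟨?_, ?_, fun y hy => ?_⟩
    · have hJm : ∀ i, MemLp (J i) 2 (volume.restrict (Ioo a b)) := fun i =>
        memLp_indicator_const 2 measurableSet_Ioc 1 (Or.inr (measure_ne_top _ _))
      exact memLp_finsetSum _ fun i _ => ((hJm (i + 1)).sub (hJm i)).const_mul _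
    · rw [hprim b (right_mem_Icc.2 hab.le)]
      have hRb : ∀ i ≤ n, R i b = h := fun i hi => by
        simp only [hR]
        rw [min_eq_right (by linarith [hxb i hi]), max_eq_left h0.le]
      refine Finset.sum_eq_zero fun i hi => ?_
      have := Finset.mem_range.1 hi
      rw [hRb (i + 1) this, hRb i this.le, sub_self, mul_zero]
    · rw [hprim y (Ioo_subset_Icc_self hy)]
      -- The ramps decrease in `i`, so the absolute values telescope to at most `h`; hence the bound
      -- `δ` does not depend on `n`.
      have hanti : ∀ i, R (i + 1) y ≤ R i y := fun i =>
        max_le_max_right 0 (min_le_min_right h (sub_le_sub_left (hx i.le_succ) y))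
      calc |∑ i ∈ Finset.range n, δ * s i * h⁻¹ * (R (i + 1) y - R i y)|
          ≤ ∑ i ∈ Finset.range n, |δ * s i * h⁻¹ * (R (i + 1) y - R i y)| :=
            Finset.abs_sum_le_sum_abs _ _
        _ ≤ ∑ i ∈ Finset.range n, δ * h⁻¹ * (R i y - R (i + 1) y) := by
            refine Finset.sum_le_sum fun i _ => ?_
            rw [abs_mul, abs_mul, abs_mul, abs_of_pos hδ, abs_of_pos (inv_pos.2 h0),
              abs_sub_comm, abs_of_nonneg (sub_nonneg.2 (hanti i))]
            have : δ * |s i| * h⁻¹ ≤ δ * h⁻¹ := by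
              have := mul_le_mul_of_nonneg_left (hs1 i) hδ.le
              rw [mul_one] at this
              exact mul_le_mul_of_nonneg_right this (inv_pos.2 h0).le
            exact mul_le_mul_of_nonneg_right this (sub_nonneg.2 (hanti i))
        _ = δ * h⁻¹ * (R 0 y - R n y) := by
            rw [← Finset.mul_sum, Finset.sum_range_sub']
        _ ≤ δ * h⁻¹ * h := by
            have h1 : R 0 y ≤ h := max_le (min_le_right _ _) h0.le
            have h2 : 0 ≤ R n y := le_max_right _ _
            have : 0 ≤ δ * h⁻¹ := by positivity
            exact mul_le_mul_of_nonneg_left (by linarith) this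
        _ = δ := by field_simp
  have hui : IntegrableOn u (Ioo a b) := (intervalIntegrable_iff_integrableOn_Ioo_of_le hab.le).1 hu
  have huJ : ∀ i, (fun t => u t * J i t) = (Ioc (x i) (x i + h)).indicator u := fun i => by
    ext t
    by_cases ht : t ∈ Ioc (x i) (x i + h) <;> simp [hJ, ht]
  have huJi : ∀ i, Integrable (fun t => u t * J i t) (volume.restrict (Ioo a b)) := fun i => by
    rw [huJ]
    exact hui.indicator measurableSet_Ioc
  have huJe : ∀ i ≤ n, ∫ t in Ioo a b, u t * J i t = U (x i + h) - U (x i) := by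
    intro i hi
    have hsub : ∀ y ∈ Icc a b, IntervalIntegrable u volume a y := fun y hy =>
      hu.mono_set (by
        rw [uIcc_of_le hab.le, uIcc_of_le hy.1]; exact Icc_subset_Icc_right hy.2)
    have hss : Ioc (x i) (x i + h) ⊆ Ioo a b := fun t ht =>
      ⟨(hxm i).1.trans ht.1, ht.2.trans_lt (hxb i hi)⟩
    rw [huJ, setIntegral_indicator measurableSet_Ioc, inter_eq_right.2 hss, hU]
    simp only
    rw [intervalIntegral.integral_interval_sub_left
      (hsub _ ⟨by linarith [(hxm i).1], (hxb i hi).le⟩) (hsub _ (Ioo_subset_Icc_self (hxm i))),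
      intervalIntegral.integral_of_le (by linarith)]
  have huq : ∫ t in Ioo a b, u t * q t = δ * ∑ i ∈ Finset.range n,
      s i * (h⁻¹ • (U (x (i + 1) + h) - U (x (i + 1))) - h⁻¹ • (U (x i + h) - U (x i))) := by
    have e : ∀ t, u t * q t = ∑ i ∈ Finset.range n,
        δ * s i * h⁻¹ * (u t * J (i + 1) t - u t * J i t) := fun t => by
      rw [hq, Finset.mul_sum]
      exact Finset.sum_congr rfl fun i _ => by ring
    simp_rw [e]
    have hi : ∀ i, Integrable (fun t => δ * s i * h⁻¹ * (u t * J (i + 1) t - u t * J i t))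
        (volume.restrict (Ioo a b)) := fun i => ((huJi (i + 1)).sub (huJi i)).const_mul _
    rw [integral_finsetSum _ fun i _ => hi i, Finset.mul_sum]
    refine Finset.sum_congr rfl fun i hi => ?_
    have := Finset.mem_range.1 hi
    rw [integral_const_mul, integral_sub (huJi _) (huJi _), huJe _ this, huJe _ this.le,
      smul_eq_mul, smul_eq_mul]
    ring
  rw [le_div_iff₀' hδ, ← huq]
  exact hM q hadm

theorem exists_isRep_of_forall_isAdmissible {a b : ℝ} (hab : a < b) {u : ℝ → ℝ}
    (hu : IntervalIntegrable u volume a b) {δ M : ℝ} (hδ : 0 < δ)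
    (hM : ∀ q, IsAdmissible a b (fun _ => δ) q → ∫ t in Ioo a b, u t * q t ≤ M) :
    ∃ P N, IsRep a b u P N := by
  -- `T` consists of points where the primitive has derivative `u x`: almost every point, by
  -- Lebesgue differentiation.
  refine isRep_of_boundedVariationOn hab
    (T := {x | x ∈ Ioo a b ∧ HasDerivAt (fun y => ∫ t in a..y, u t) (u x) x}) ?_ ?_
  · filter_upwards [ae_restrict_mem measurableSet_Ioo,
      ae_restrict_of_ae hu.ae_hasDerivAt_integral] with x hx h
    exact ⟨hx, h (by rw [uIcc_of_le hab.le]; exact Ioo_subset_Icc_self hx) a left_mem_uIcc⟩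
  · refine ne_top_of_le_ne_top (ENNReal.ofReal_ne_top (r := M / δ)) (iSup_le ?_)
    rintro ⟨n, x, hx, hxT⟩
    simp only [edist_dist, Real.dist_eq]
    rw [← ENNReal.ofReal_sum_of_nonneg fun _ _ => abs_nonneg _]
    exact ENNReal.ofReal_le_ofReal (sum_abs_sub_le_of_forall_isAdmissible hab hu hδ hM hx
      (fun i => (hxT i).1) (fun i => (hxT i).2) n)

/-! ### Complementary slackness and existence of certificates -/

/-- Complementary slackness: `Du ≤ 0` where the constraint on the primitive of `-p` is inactive. -/
theorem IsRep.primitive_ae_eq {a b : ℝ} (hab : a < b) {α u p : ℝ → ℝ}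
    (hα : ContinuousOn α (Icc a b)) {P N : Measure ℝ} (hr : IsRep a b u P N)
    (hp : IsAdmissible a b α p)
    (hopt : ∀ q, IsAdmissible a b α q → ∫ x in Ioo a b, u x * q x ≤ ∫ x in Ioo a b, u x * p x)
    {s : Set ℝ} (hs : MeasurableSet s) (hPs : P s = 0) (hNs : N sᶜ = 0) :
    ∀ᵐ x ∂P, - ∫ t in a..x, p t = α x := by
  have := hr.finite_left
  have := hr.finite_right
  have hpi := hp.intervalIntegrable hab
  set Y : ℝ → ℝ := fun x => α x + ∫ t in a..x, p t with hY
  have hYc : ContinuousOn Y (Icc a b) := hα.add (continuousOn_primitive hab hpi)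
  set O : Set ℝ := Ioo a b ∩ Y ⁻¹' Ioi 0 with hO
  have hOo : IsOpen O := (hYc.mono Ioo_subset_Icc_self).isOpen_inter_preimage isOpen_Ioo isOpen_Ioi
  have hPO : P (O ∩ sᶜ) ≤ N (O ∩ sᶜ) := by
    refine measure_le_of_forall_contDiff hOo (fun η h1 h2 h3 h4 h5 => ?_)
      (hOo.measurableSet.inter hs.compl) inter_subset_left
    have hηs : tsupport η ⊆ Ioo a b := h3.trans inter_subset_left
    -- `τ` is the least slack on the support of `η`, so lowering the primitive by `τ η` keeps it
    -- above `-α`.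
    obtain ⟨τ, hτ, hτY⟩ : ∃ τ > 0, ∀ x ∈ tsupport η, τ ≤ Y x := by
      rcases (tsupport η).eq_empty_or_nonempty with h | h
      · exact ⟨1, one_pos, by simp [h]⟩
      · obtain ⟨x₀, hx₀, hmin⟩ := h2.isCompact.exists_isMinOn h
          (hYc.mono (hηs.trans Ioo_subset_Icc_self))
        exact ⟨Y x₀, (h3 hx₀).2, fun x hx => hmin hx⟩
    have hd : Continuous (deriv η) := h1.continuous_deriv (by simp)
    have hdi : ∀ x y, IntervalIntegrable (fun t => τ * deriv η t) volume x y := fun x y =>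
      (continuous_const.mul hd).intervalIntegrable x y
    have hprim : ∀ x ∈ Icc a b, ∫ t in a..x, (p t - τ * deriv η t)
        = (∫ t in a..x, p t) - τ * η x := by
      intro x hx
      rw [intervalIntegral.integral_sub (hpi.mono_set (by
        rw [uIcc_of_le hx.1, uIcc_of_le hab.le]; exact Icc_subset_Icc_right hx.2)) (hdi a x),
        intervalIntegral.integral_const_mul, integral_deriv_eq h1 hηs]
    obtain ⟨C, hC⟩ := h2.deriv.exists_bound_of_continuous hd
    have hdL : MemLp (deriv η) 2 (volume.restrict (Ioo a b)) :=
      MemLp.of_bound hd.aestronglyMeasurable C (Filter.Eventually.of_forall hC)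
    have hq : IsAdmissible a b α fun t => p t - τ * deriv η t := by
      refine ⟨hp.memLp.sub (hdL.const_mul τ), ?_, fun x hx => ?_⟩
      · rw [hprim b (right_mem_Icc.2 hab.le), hp.integral_eq_zero,
          image_eq_zero_of_notMem_tsupport fun h => (hηs h).2.ne rfl]
        ring
      · rw [hprim x (Ioo_subset_Icc_self hx)]
        obtain ⟨hl, hu⟩ := abs_le.1 (hp.abs_primitive_le x hx)
        have hτη : 0 ≤ τ * η x := mul_nonneg hτ.le (h4 x)
        refine abs_le.2 ⟨?_, by linarith⟩
        by_cases hxs : x ∈ tsupport η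
        · have h6 := hτY x hxs
          have h7 : τ * η x ≤ τ := mul_le_of_le_one_right hτ.le (h5 x)
          simp only [hY] at h6
          linarith
        · rw [image_eq_zero_of_notMem_tsupport hxs]
          linarith
    -- Optimality against `p - τ η'` yields `∫ u η' ≥ 0`, that is, `∫ η dP ≤ ∫ η dN`.
    have h := hopt _ hq
    have i1 : Integrable (fun x => u x * p x) (volume.restrict (Ioo a b)) :=
      (hr.memLp 2).integrable_mul hp.memLp
    have i2 : Integrable (fun x => u x * deriv η x) (volume.restrict (Ioo a b)) :=
      (hr.memLp 2).integrable_mul hdL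
    have e : ∫ x in Ioo a b, u x * (p x - τ * deriv η x)
        = (∫ x in Ioo a b, u x * p x) - τ * ∫ x in Ioo a b, u x * deriv η x := by
      rw [← integral_const_mul, ← integral_sub i1 (i2.const_mul τ)]
      exact integral_congr_ae (Filter.Eventually.of_forall fun x => by simp only; ring)
    rw [e, hr.integral_mul_deriv hab h1 hηs] at h
    have : 0 ≤ τ * (∫ t, η t ∂N - ∫ t, η t ∂P) := by linarith
    linarith [nonneg_of_mul_nonneg_right this hτ]
  have hPO0 : P (O ∩ sᶜ) = 0 :=
    le_antisymm (hPO.trans_eq (measure_mono_null inter_subset_right hNs)) bot_le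
  have hI : ∀ᵐ x ∂P, x ∈ Ioo a b := hr.carried_left
  filter_upwards [hI, measure_eq_zero_iff_ae_notMem.1 hPO0,
    measure_eq_zero_iff_ae_notMem.1 hPs] with x hx hxO hxs
  have h1 : ¬ 0 < Y x := fun h => hxO ⟨⟨hx, h⟩, hxs⟩
  have h2 := (abs_le.1 (hp.abs_primitive_le x hx)).1
  simp only [hY, not_lt] at h1
  linarith

theorem exists_isCert {a b : ℝ} (hab : a < b) {f : L1 a b} (hf : f ∈ BV a b) {α : ℝ → ℝ}
    (hα : ContinuousOn α (Icc a b)) (hpos : ∀ x ∈ Icc a b, 0 < α x) :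
    ∃ u, IsCert α f u := by
  have hfL := (isRep_D hab hf).memLp 2
  obtain ⟨p, hp, hopt⟩ := exists_isAdmissible_projection hab
    (fun x hx => (hpos x (Ioo_subset_Icc_self hx)).le) hfL
  have huL : MemLp (fun x => f x - p x) 2 (volume.restrict (Ioo a b)) := hfL.sub hp.memLp
  have huL1 : MemLp (fun x => f x - p x) 1 (volume.restrict (Ioo a b)) :=
    huL.mono_exponent (by norm_num)
  set u : L1 a b := huL1.toLp _ with hu
  have hue : ∀ᵐ x ∂volume.restrict (Ioo a b), u x = f x - p x := huL1.coeFn_toLp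
  have huq : ∀ q : ℝ → ℝ, ∫ x in Ioo a b, (f x - p x) * q x = ∫ x in Ioo a b, u x * q x :=
    fun q => integral_congr_ae (by filter_upwards [hue] with x hx; rw [hx])
  simp_rw [huq] at hopt
  have hprim : ∀ x ∈ Icc a b, ∫ t in a..x, (u t - f t) = - ∫ t in a..x, p t := by
    intro x hx
    rw [← intervalIntegral.integral_neg, ← setIntegral_Ioc_restrict_Ioo hx,
      ← setIntegral_Ioc_restrict_Ioo hx]
    refine integral_congr_ae (ae_restrict_of_ae ?_)
    filter_upwards [hue] with t ht
    rw [ht]; ring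
  -- The positive minimum of `α` makes every function admissible for that constant admissible for
  -- `α`, so the variational inequality supplies the bound needed for bounded variation.
  obtain ⟨x₀, hx₀, hmin⟩ := isCompact_Icc.exists_isMinOn (nonempty_Icc.2 hab.le) hα
  obtain ⟨P₀, N₀, hr₀⟩ := exists_isRep_of_forall_isAdmissible hab (u := u)
    ((intervalIntegrable_iff_integrableOn_Ioo_of_le hab.le).2 (L1.integrable_coeFn u))
    (hpos x₀ hx₀) (fun q hq => hopt q ⟨hq.memLp, hq.integral_eq_zero, fun x hx =>
      (hq.abs_primitive_le x hx).trans (hmin (Ioo_subset_Icc_self hx))⟩)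
  have huBV : u ∈ BV a b := hr₀.mem_BV hab
  have hr := isRep_D hab huBV
  obtain ⟨s, hs, hs1, hs2⟩ := exists_Dpos_Dneg_separation u
  refine ⟨u, huBV, ?_, fun x hx => ?_, ?_, ?_⟩
  · rw [hprim b (right_mem_Icc.2 hab.le), hp.integral_eq_zero, neg_zero]
  · rw [hprim x (Ioo_subset_Icc_self hx), abs_neg]
    exact hp.abs_primitive_le x hx
  · have hI : ∀ᵐ x ∂Dpos u, x ∈ Ioo a b := hr.carried_left
    filter_upwards [hI, hr.primitive_ae_eq hab hα hp hopt hs hs1 hs2] with x hx h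
    rw [hprim x (Ioo_subset_Icc_self hx), h]
  · have hI : ∀ᵐ x ∂Dneg u, x ∈ Ioo a b := hr.carried_right
    -- The negative part is the positive part for `-u`, with `-p` optimal by symmetry of the
    -- admissible set.
    filter_upwards [hI, hr.neg.primitive_ae_eq hab hα hp.neg (fun q hq => by
      have := hopt _ hq.neg
      simpa [neg_mul, mul_neg] using this) hs.compl hs2 (by rwa [compl_compl])] with x hx h
    rw [hprim x (Ioo_subset_Icc_self hx), ← h]
    simp

end WeightedTV

end

/-- The weighted total variation problems with data `f` and weight `α₁`, with data `S_{α₁}(f)` and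
weight `α₂`, and with data `f` and weight `α₁ + α₂` each have exactly one minimiser, and
`S_{α₁+α₂}(f) = S_{α₂}(S_{α₁}(f))`. -/
theorem proposition3p12 (a b : ℝ) (hab : a < b)
    (f : WeightedTV.L1 a b) (hf : f ∈ WeightedTV.BV a b)
    (α₁ : ℝ → ℝ) (hα₁ : ContinuousOn α₁ (Set.Icc a b)) (hα₁_pos : ∀ x ∈ Set.Icc a b, 0 < α₁ x)
    (α₂ : ℝ) (hα₂ : 0 < α₂) :
    ∃ u₁ u₂ : WeightedTV.L1 a b,
      WeightedTV.S α₁ f = {u₁} ∧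
      WeightedTV.S (fun _ => α₂) u₁ = {u₂} ∧
      WeightedTV.S (fun x => α₁ x + α₂) f = {u₂} := by
  obtain ⟨u₁, h₁⟩ := WeightedTV.exists_isCert hab hf hα₁ hα₁_pos
  obtain ⟨u₂, h₂⟩ := WeightedTV.exists_isCert hab h₁.mem_BV (α := fun _ => α₂)
    continuousOn_const fun _ _ => hα₂
  exact ⟨u₁, u₂, h₁.S_eq hab hα₁ hf, h₂.S_eq hab continuousOn_const h₁.mem_BV,
    (h₁.comp hab hα₂ h₂).S_eq hab (hα₁.add continuousOn_const) hf⟩
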